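/- Let $G$ be a discrete group and $A$ a $C^*$-algebra. A partial action $\alpha$ of $G$ on $A$ consists of closed two-sided ideals $\{D_s\}_{s\in G}$ of $A$ and $*$-isomorphisms $\alpha_s\colon D_{s^{-1}}\to D_s$ such that $D_e=A$ and, for all $s,t\in G$, $\alpha_{st}$ extends $\alpha_s\alpha_t$ (whose domain is $\{x\in D_{t^{-1}} : \alpha_t(x)\in D_{s^{-1}}\}$). Let $L_c$ be the $*$-algebra of finitely supported functions $f\colon G\to A$ with $f(s)\in D_s$ for all $s$; writing $F(a,s)$, for $a\in D_s$, for the function with value $a$ at $s$ and $0$ elsewhere, its operations are determined by $$F(a,s)F(b,t)=F(\alpha_s(\alpha_s^{-1}(a)b),st),\qquad F(a,s)^*=F(\alpha_s^{-1}(a^*),s^{-1}).$$ The crossed product $A\rtimes_\alpha G$ is the completion of $L_c$ in its greatest $C^*$-seminorm. Let $X_s=\{F(a,s): a\in D_s\}\subset A\rtimes_\alpha G$, and let $m_s$ be the multiplier of the $D_s$–$D_{s^{-1}}$ bimodule $X_s$ given by $a m_s=F(a,s)$ for $a\in D_s$ and $m_s b=F(\alpha_s(b),s)$ for $b\in D_{s^{-1}}$.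 Let $C^*(G)$ be the full group $C^*$-algebra, let $s\in G$ also denote the corresponding unitary in $C^*(G)$, let $\otimes$ be the minimal tensor product of $C^*$-algebras, and let $\delta_G\colon C^*(G)\to C^*(G)\otimes C^*(G)$ be the $*$-homomorphism with $\delta_G(s)=s\otimes s$. A coaction of $G$ on a $C^*$-algebra $B$ is an injective nondegenerate $*$-homomorphism $\delta\colon B\to B\otimes C^*(G)$ such that $(\delta\otimes\mathrm{id})\circ\delta=(\mathrm{id}\otimes\delta_G)\circ\delta$; here nondegenerate means that the linear span of $\delta(B)(B\otimes C^*(G))$ is dense in $B\otimes C^*(G)$. For $s\in G$ its spectral subspace is $B_s=\{b\in B:\delta(b)=b\otimes s\}$. **Proposition.** For every partial action $\alpha$ of a discrete group $G$ on a $C^*$-algebra $A$ there is a unique coaction $\hat\alpha$ of $G$ on $A\rtimes_\alpha G$ such that $$\hat\alpha(a m_s)=a m_s\otimes s\qquad\text{for all } s\in G,\ a\in D_s .$$ Its spectral subspaces are $$(A\rtimes_\alpha G)_s=D_s m_s=m_s D_{s^{-1}}\qquad (s\in G),$$ where $D_sm_s=\{am_s: a\in D_s\}$ and $m_sD_{s^{-1}}=\{m_sb: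 b\in D_{s^{-1}}\}$. -/

import Mathlib

universe u v w


open scoped TensorProduct

noncomputable section

/-! ### Completing a seminormed *-algebra whose seminorm satisfies the C*-identity -/

namespace CStarCompletion

open UniformSpace

variable (E : Type*) [NonUnitalSeminormedRing E] [StarRing E] [NormedSpace ℂ E]
  [IsScalarTower ℂ E E] [SMulCommClass ℂ E E] [StarModule ℂ E] [NormedStarGroup E]

variable {E} in
theorem norm_mul_completion_le (x : E) (y : Completion E) :
    ‖(ContinuousLinearMap.mul ℂ E x).completion y‖ ≤ ‖x‖ * ‖y‖ := by
  induction y using Completion.induction_on with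
  | hp => exact isClosed_le (by fun_prop) (by fun_prop)
  | ih y => simpa using norm_mul_le x y

/-- Left multiplication by elements of `E`, as operators on the completion. -/
def mulLeft : E →L[ℂ] (Completion E →L[ℂ] Completion E) :=
  LinearMap.mkContinuous
    { toFun := fun x => (ContinuousLinearMap.mul ℂ E x).completion
      map_add' := fun x y => by
        ext z
        induction z using Completion.induction_on with
        | hp => exact isClosed_eq (ContinuousLinearMap.continuous _) (ContinuousLinearMap.continuous _)
        | ih z => simp [Completion.coe_add]
      map_smul' := fun c x => by
        ext z
        induction z using Completion.induction_on with
        | hp => exact isClosed_eq (ContinuousLinearMap.continuous _) (ContinuousLinearMap.continuous _)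
        | ih z => simp [Completion.coe_smul] }
    1 (fun x => by
      rw [one_mul]
      exact ContinuousLinearMap.opNorm_le_bound _ (norm_nonneg x) (norm_mul_completion_le x))

/-- Multiplication of the completion as a continuous bilinear map. -/
def mulL : Completion E →L[ℂ] Completion E →L[ℂ] Completion E :=
  (mulLeft E).fromCompletion

theorem mulL_coe (x y : E) :
    mulL E (x : Completion E) (y : Completion E) = ((x * y : E) : Completion E) := by
  rw [mulL, ContinuousLinearMap.fromCompletion_apply_coe]
  exact ContinuousLinearMap.completion_apply_coe (ContinuousLinearMap.mul ℂ E x) y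

/-- The involution of the completion. -/
def starC : Completion E → Completion E := Completion.map star

theorem starC_coe (x : E) : starC E (x : Completion E) = ((star x : E) : Completion E) :=
  Completion.map_coe (starₗᵢ ℂ (E := E)).isometry.uniformContinuous x

theorem continuous_starC : Continuous (starC E) := Completion.continuous_map

theorem continuous_mulL₂ {X : Type*} [TopologicalSpace X] {f g : X → Completion E}
    (hf : Continuous f) (hg : Continuous g) : Continuous fun x => mulL E (f x) (g x) :=
  (mulL E).continuous₂.comp (hf.prodMk hg)

/-- The multiplication of the completion. -/
abbrev nonUnitalNormedRing : NonUnitalNormedRing (Completion E) where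
  __ := (inferInstance : NormedAddCommGroup (Completion E))
  mul x y := mulL E x y
  left_distrib x y z := map_add (mulL E x) y z
  right_distrib x y z := by
    change mulL E (x + y) z = mulL E x z + mulL E y z
    simp
  zero_mul x := by change mulL E 0 x = 0; simp
  mul_zero x := by change mulL E x 0 = 0; simp
  mul_assoc x y z := by
    change mulL E (mulL E x y) z = mulL E x (mulL E y z)
    induction x, y, z using Completion.induction_on₃ with
    | hp =>
      refine isClosed_eq ?_ ?_
      · exact continuous_mulL₂ E (continuous_mulL₂ E (by fun_prop) (by fun_prop)) (by fun_prop)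
      · exact continuous_mulL₂ E (by fun_prop) (continuous_mulL₂ E (by fun_prop) (by fun_prop))
    | ih a b c => simp only [mulL_coe, mul_assoc]
  norm_mul_le x y := by
    change ‖mulL E x y‖ ≤ ‖x‖ * ‖y‖
    induction x, y using Completion.induction_on₂ with
    | hp =>
      exact isClosed_le (continuous_mulL₂ E (by fun_prop) (by fun_prop)).norm (by fun_prop)
    | ih a b => simpa only [mulL_coe, Completion.norm_coe] using norm_mul_le a b

/-- The completion is a C*-algebra. -/
abbrev cstarAlgebra (hE : ∀ x : E, ‖x‖ * ‖x‖ ≤ ‖star x * x‖) :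
    NonUnitalCStarAlgebra (Completion E) where
  __ := nonUnitalNormedRing E
  __ := (inferInstance : NormedSpace ℂ (Completion E))
  __ := (inferInstance : CompleteSpace (Completion E))
  star := starC E
  star_involutive x := by
    induction x using Completion.induction_on with
    | hp => exact isClosed_eq ((continuous_starC E).comp (continuous_starC E)) continuous_id
    | ih a => simp only [starC_coe, star_star]
  star_mul x y := by
    change starC E (mulL E x y) = mulL E (starC E y) (starC E x)
    have hc := continuous_starC E
    induction x, y using Completion.induction_on₂ with
    | hp =>
      exact isClosed_eq (hc.comp (continuous_mulL₂ E (by fun_prop) (by fun_prop)))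
        (continuous_mulL₂ E (by fun_prop) (by fun_prop))
    | ih a b => simp only [mulL_coe, starC_coe, star_mul]
  star_add x y := by
    change starC E (x + y) = starC E x + starC E y
    have hc := continuous_starC E
    induction x, y using Completion.induction_on₂ with
    | hp => exact isClosed_eq (by fun_prop) (by fun_prop)
    | ih a b => simp only [← Completion.coe_add, starC_coe, star_add]
  norm_mul_self_le x := by
    change ‖x‖ * ‖x‖ ≤ ‖mulL E (starC E x) x‖
    have hc := continuous_starC E
    induction x using Completion.induction_on with
    | hp => exact isClosed_le (by fun_prop) (continuous_mulL₂ E (by fun_prop) (by fun_prop)).norm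
    | ih a =>
      simp only [starC_coe, mulL_coe, Completion.norm_coe]
      exact hE a
  smul_assoc c x y := by
    change mulL E (c • x) y = c • mulL E x y
    simp
  smul_comm c x y := by
    change c • mulL E x y = mulL E x (c • y)
    simp
  star_smul c x := by
    change starC E (c • x) = star c • starC E x
    have hc := continuous_starC E
    induction x using Completion.induction_on with
    | hp => exact isClosed_eq (hc.comp (continuous_const_smul c)) (hc.const_smul (star c))
    | ih a => simp only [← Completion.coe_smul, starC_coe, star_smul]

end CStarCompletion

/-! ### C*-seminorms and C*-completions of *-algebras -/

/-- A C*-seminorm on a complex *-algebra: a submultiplicative seminorm with `p (x* x) = p x ^ 2`. -/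
structure CStarSeminorm (L : Type*) [NonUnitalRing L] [StarRing L] [Module ℂ L] extends
    Seminorm ℂ L where
  mul_le' : ∀ x y, toFun (x * y) ≤ toFun x * toFun y
  star_mul_self' : ∀ x, toFun (star x * x) = toFun x * toFun x

namespace CStarSeminorm

section Basic

variable {L : Type*} [NonUnitalRing L] [StarRing L] [Module ℂ L]

instance : CoeFun (CStarSeminorm L) (fun _ => L → ℝ) := ⟨fun p => p.toSeminorm⟩

theorem mul_le (p : CStarSeminorm L) (x y : L) : p (x * y) ≤ p x * p y := p.mul_le' x y

theorem star_mul_self (p : CStarSeminorm L) (x : L) : p (star x * x) = p x * p x :=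
  p.star_mul_self' x

theorem nonneg (p : CStarSeminorm L) (x : L) : 0 ≤ p x := apply_nonneg p.toSeminorm x

theorem le_star (p : CStarSeminorm L) (x : L) : p x ≤ p (star x) := by
  rcases (p.nonneg x).eq_or_lt with h | h
  · rw [← h]; exact p.nonneg _
  · have := p.mul_le (star x) x
    rw [p.star_mul_self] at this
    exact le_of_mul_le_mul_right this h

theorem star_eq (p : CStarSeminorm L) (x : L) : p (star x) = p x :=
  le_antisymm (by simpa using p.le_star (star x)) (p.le_star x)

/-- The pointwise supremum of a pointwise bounded family of C*-seminorms. -/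
def sup {ι : Type*} (p : ι → CStarSeminorm L) (h : ∀ x, BddAbove (Set.range fun i => p i x)) :
    CStarSeminorm L where
  toFun x := ⨆ i, p i x
  map_zero' := by simp
  add_le' x y := by
    have h0 : ∀ z, 0 ≤ ⨆ i, p i z := fun z => Real.iSup_nonneg fun i => (p i).nonneg z
    refine Real.iSup_le (fun i => ?_) (add_nonneg (h0 x) (h0 y))
    exact (map_add_le_add (p i).toSeminorm x y).trans
      (add_le_add (le_ciSup (h x) i) (le_ciSup (h y) i))
  neg' x := by simp
  smul' c x := by
    simp only [map_smul_eq_mul]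
    rw [Real.mul_iSup_of_nonneg (norm_nonneg c)]
  mul_le' x y := by
    have h0 : ∀ z, 0 ≤ ⨆ i, p i z := fun z => Real.iSup_nonneg fun i => (p i).nonneg z
    refine Real.iSup_le (fun i => ?_) (mul_nonneg (h0 x) (h0 y))
    exact ((p i).mul_le x y).trans
      (mul_le_mul (le_ciSup (h x) i) (le_ciSup (h y) i) ((p i).nonneg y) (h0 x))
  star_mul_self' x := by
    have h0 : ∀ z, 0 ≤ ⨆ i, p i z := fun z => Real.iSup_nonneg fun i => (p i).nonneg z
    apply le_antisymm
    · refine Real.iSup_le (fun i => ?_) (mul_nonneg (h0 x) (h0 x))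
      rw [(p i).star_mul_self]
      exact mul_le_mul (le_ciSup (h x) i) (le_ciSup (h x) i) ((p i).nonneg x) (h0 x)
    · rw [← sq]
      refine (Real.le_sqrt (h0 x) (h0 _)).1 (Real.iSup_le (fun i => ?_) (Real.sqrt_nonneg _))
      refine (Real.le_sqrt ((p i).nonneg x) (h0 _)).2 ?_
      rw [sq, ← (p i).star_mul_self]
      exact le_ciSup (h (star x * x)) i

theorem le_sup {ι : Type*} (p : ι → CStarSeminorm L)
    (h : ∀ x, BddAbove (Set.range fun i => p i x)) (i : ι) (x : L) : p i x ≤ sup p h x :=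
  le_ciSup (h x) i

theorem sup_le {ι : Type*} (p : ι → CStarSeminorm L)
    (h : ∀ x, BddAbove (Set.range fun i => p i x)) {x : L} {c : ℝ} (hc : 0 ≤ c)
    (hx : ∀ i, p i x ≤ c) : sup p h x ≤ c :=
  Real.iSup_le hx hc

/-- The C*-seminorm `x ↦ ‖φ x‖` of a *-homomorphism `φ` into a C*-algebra. -/
def ofHom {B : Type*} [NonUnitalCStarAlgebra B] (φ : L →⋆ₙₐ[ℂ] B) : CStarSeminorm L where
  toFun x := ‖φ x‖
  map_zero' := by simp
  add_le' x y := by rw [map_add]; exact norm_add_le _ _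
  neg' x := by rw [map_neg, norm_neg]
  smul' c x := by rw [map_smul, norm_smul]
  mul_le' x y := by rw [map_mul]; exact norm_mul_le _ _
  star_mul_self' x := by rw [map_mul, map_star, CStarRing.norm_star_mul_self]

theorem ofHom_apply {B : Type*} [NonUnitalCStarAlgebra B] (φ : L →⋆ₙₐ[ℂ] B) (x : L) :
    ofHom φ x = ‖φ x‖ := rfl

end Basic

section Completion

variable {L : Type*} [NonUnitalRing L] [StarRing L] [Module ℂ L] [IsScalarTower ℂ L L]
  [SMulCommClass ℂ L L] [StarModule ℂ L]

/-- The *-algebra `L`, equipped with the topology of the C*-seminorm `p`. -/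
def Dom (_ : CStarSeminorm L) : Type _ := L

variable (p : CStarSeminorm L)

instance : NonUnitalSeminormedRing p.Dom where
  __ := (inferInstanceAs (NonUnitalRing L) : NonUnitalRing p.Dom)
  __ : SeminormedAddCommGroup p.Dom := p.toSeminorm.toSeminormedAddCommGroup
  norm_mul_le := p.mul_le

instance : StarRing p.Dom := inferInstanceAs (StarRing L)

instance : NormedSpace ℂ p.Dom where
  __ := (inferInstanceAs (Module ℂ L) : Module ℂ p.Dom)
  norm_smul_le c x := (map_smul_eq_mul p.toSeminorm c x).le

instance : IsScalarTower ℂ p.Dom p.Dom := inferInstanceAs (IsScalarTower ℂ L L)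
instance : SMulCommClass ℂ p.Dom p.Dom := inferInstanceAs (SMulCommClass ℂ L L)
instance : StarModule ℂ p.Dom := inferInstanceAs (StarModule ℂ L)

instance : NormedStarGroup p.Dom where
  norm_star_le x := (p.star_eq (x : L)).le

/-- The identity map, as a *-homomorphism. -/
def toDom : L →⋆ₙₐ[ℂ] p.Dom where
  toFun x := x
  map_smul' _ _ := rfl
  map_zero' := rfl
  map_add' _ _ := rfl
  map_mul' _ _ := rfl
  map_star' _ := rfl

/-- The C*-completion of a *-algebra in a C*-seminorm (its Hausdorff completion). -/
def Completion : Type _ := UniformSpace.Completion p.Dom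

instance : NonUnitalCStarAlgebra p.Completion := 
  CStarCompletion.cstarAlgebra p.Dom fun x => (p.star_mul_self (x : L)).ge

/-- The canonical *-homomorphism of `L` into its completion. -/
def toCompletion : L →⋆ₙₐ[ℂ] p.Completion where
  toFun x := ((p.toDom x : p.Dom) : UniformSpace.Completion p.Dom)
  map_smul' c x := UniformSpace.Completion.coe_smul c (p.toDom x)
  map_zero' := UniformSpace.Completion.coe_zero
  map_add' x y := UniformSpace.Completion.coe_add (p.toDom x) (p.toDom y)
  map_mul' x y := (CStarCompletion.mulL_coe p.Dom (p.toDom x) (p.toDom y)).symm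
  map_star' x := (CStarCompletion.starC_coe p.Dom (p.toDom x)).symm

theorem norm_toCompletion (x : L) : ‖p.toCompletion x‖ = p x :=
  UniformSpace.Completion.norm_coe (p.toDom x)

theorem denseRange_toCompletion : DenseRange p.toCompletion :=
  UniformSpace.Completion.denseRange_coe (α := p.Dom)

variable {B : Type*} [NonUnitalCStarAlgebra B]

/-- The continuous linear extension underlying `CStarSeminorm.lift`. -/
def liftL (φ : L →⋆ₙₐ[ℂ] B) (h : ∀ x, ‖φ x‖ ≤ p x) : p.Completion →L[ℂ] B :=
  (LinearMap.mkContinuous (E := p.Dom)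
    { toFun := fun x => φ x
      map_add' := fun x y => map_add φ _ _
      map_smul' := fun c x => map_smul φ c _ } 1
    (fun x => by rw [one_mul]; exact h x)).fromCompletion

theorem liftL_coe (φ : L →⋆ₙₐ[ℂ] B) (h : ∀ x, ‖φ x‖ ≤ p x) (x : L) :
    p.liftL φ h (p.toCompletion x) = φ x :=
  ContinuousLinearMap.fromCompletion_apply_coe (α := p.Dom) _ x

/-- A *-homomorphism of `L` into a C*-algebra which is dominated by `p` extends to the
completion. -/
def lift (φ : L →⋆ₙₐ[ℂ] B) (h : ∀ x, ‖φ x‖ ≤ p x) : p.Completion →⋆ₙₐ[ℂ] B where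
  __ := p.liftL φ h
  map_zero' := map_zero (p.liftL φ h)
  map_mul' x y := by
    refine p.denseRange_toCompletion.induction_on₂
      (p := fun x y => p.liftL φ h (x * y) = p.liftL φ h x * p.liftL φ h y) ?_ (fun a b => ?_) x y
    · exact isClosed_eq (by fun_prop) (by fun_prop)
    · rw [← map_mul, liftL_coe, liftL_coe, liftL_coe, map_mul]
  map_star' x := by
    refine p.denseRange_toCompletion.induction_on
      (p := fun x => p.liftL φ h (star x) = star (p.liftL φ h x)) x ?_ (fun a => ?_)
    · exact isClosed_eq (by fun_prop) (by fun_prop)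
    · rw [← map_star, liftL_coe, liftL_coe, map_star]

theorem lift_coe (φ : L →⋆ₙₐ[ℂ] B) (h : ∀ x, ‖φ x‖ ≤ p x) (x : L) :
    p.lift φ h (p.toCompletion x) = φ x := p.liftL_coe φ h x

end Completion
end CStarSeminorm
/-! ### Enveloping C*-algebras -/

/-- Every element of `L` has bounded C*-seminorms, so that a greatest C*-seminorm exists. -/
class IsCStarBounded (L : Type*) [NonUnitalRing L] [StarRing L] [Module ℂ L] : Prop where
  bddAbove : ∀ x : L, BddAbove (Set.range fun p : CStarSeminorm L => p x)

section Envelope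

variable (L : Type*) [NonUnitalRing L] [StarRing L] [Module ℂ L] [IsScalarTower ℂ L L]
  [SMulCommClass ℂ L L] [StarModule ℂ L] [IsCStarBounded L]

/-- The greatest C*-seminorm on `L`. -/
def greatestCStarSeminorm : CStarSeminorm L :=
  CStarSeminorm.sup (fun p : CStarSeminorm L => p) IsCStarBounded.bddAbove

/-- The enveloping C*-algebra of `L`: its completion in the greatest C*-seminorm. -/
def EnvelopingCStar : Type _ := (greatestCStarSeminorm L).Completion

instance : NonUnitalCStarAlgebra (EnvelopingCStar L) :=
  inferInstanceAs (NonUnitalCStarAlgebra (greatestCStarSeminorm L).Completion)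

namespace EnvelopingCStar

variable {L}

/-- The canonical *-homomorphism of `L` into its enveloping C*-algebra. -/
def of : L →⋆ₙₐ[ℂ] EnvelopingCStar L := (greatestCStarSeminorm L).toCompletion

theorem norm_of (x : L) : ‖of x‖ = greatestCStarSeminorm L x :=
  (greatestCStarSeminorm L).norm_toCompletion x

theorem denseRange_of : DenseRange (of : L → EnvelopingCStar L) :=
  (greatestCStarSeminorm L).denseRange_toCompletion

/-- Every *-homomorphism of `L` into a C*-algebra extends to the enveloping C*-algebra. -/
def lift {B : Type*} [NonUnitalCStarAlgebra B] (φ : L →⋆ₙₐ[ℂ] B) : EnvelopingCStar L →⋆ₙₐ[ℂ] B :=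
  (greatestCStarSeminorm L).lift φ fun x =>
    CStarSeminorm.le_sup (fun p : CStarSeminorm L => p) IsCStarBounded.bddAbove
      (CStarSeminorm.ofHom φ) x

theorem lift_of {B : Type*} [NonUnitalCStarAlgebra B] (φ : L →⋆ₙₐ[ℂ] B) (x : L) :
    lift φ (of x) = φ x :=
  (greatestCStarSeminorm L).lift_coe φ _ x

end EnvelopingCStar

end Envelope

/-! ### The full group C*-algebra of a discrete group -/

section GroupCStar

open MonoidAlgebra

variable (G : Type v) [Group G]

/-- The involution of the complex group algebra: `f* (s) = conj (f (s⁻¹))`. -/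
instance : Star (MonoidAlgebra ℂ G) :=
  ⟨fun f => MonoidAlgebra.ofCoeff
    (Finsupp.equivMapDomain (Equiv.inv G) (f.coeff.mapRange star (star_zero ℂ)))⟩

variable {G}

theorem MonoidAlgebra.coeff_star_apply (f : MonoidAlgebra ℂ G) (s : G) :
    (star f).coeff s = star (f.coeff s⁻¹) := rfl

theorem MonoidAlgebra.star_single (s : G) (c : ℂ) :
    star (single s c : MonoidAlgebra ℂ G) = single s⁻¹ (star c) := by
  classical
  ext t
  rw [MonoidAlgebra.coeff_star_apply]
  simp only [MonoidAlgebra.coeff_single, Finsupp.single_apply, inv_eq_iff_eq_inv]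
  split_ifs <;> simp

instance : StarAddMonoid (MonoidAlgebra ℂ G) where
  star_involutive f := by ext s; simp [MonoidAlgebra.coeff_star_apply]
  star_add f g := by ext s; simp [MonoidAlgebra.coeff_star_apply]

instance : StarRing (MonoidAlgebra ℂ G) where
  __ := (inferInstance : StarAddMonoid (MonoidAlgebra ℂ G))
  star_mul f g := by
    induction f using MonoidAlgebra.induction_linear with
    | zero => simp
    | add f₁ f₂ h₁ h₂ => rw [add_mul, star_add, h₁, h₂, star_add, mul_add]
    | single s c =>
      induction g using MonoidAlgebra.induction_linear with
      | zero => simp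
      | add f₁ f₂ h₁ h₂ => rw [mul_add, star_add, h₁, h₂, star_add, add_mul]
      | single t d =>
        simp only [MonoidAlgebra.star_single, MonoidAlgebra.single_mul_single, mul_inv_rev, star_mul]

instance : StarModule ℂ (MonoidAlgebra ℂ G) where
  star_smul c f := by ext s; simp [MonoidAlgebra.coeff_star_apply]

instance : IsCStarBounded (MonoidAlgebra ℂ G) where
  bddAbove f := by
    induction f using MonoidAlgebra.induction_linear with
    | zero => exact ⟨0, by rintro _ ⟨p, rfl⟩; simp⟩
    | add f₁ f₂ h₁ h₂ =>
      obtain ⟨c₁, h₁⟩ := h₁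
      obtain ⟨c₂, h₂⟩ := h₂
      refine ⟨c₁ + c₂, ?_⟩
      rintro _ ⟨p, rfl⟩
      exact (map_add_le_add p.toSeminorm f₁ f₂).trans
        (add_le_add (h₁ ⟨p, rfl⟩) (h₂ ⟨p, rfl⟩))
    | single s c =>
      refine ⟨‖c‖, ?_⟩
      rintro _ ⟨p, rfl⟩
      have h1 : p (1 : MonoidAlgebra ℂ G) ≤ 1 := by
        have h := p.star_mul_self 1
        rw [star_one, one_mul] at h
        have h0 := p.nonneg 1
        by_contra! hlt
        nlinarith
      have h2 := p.star_mul_self (single s c)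
      rw [MonoidAlgebra.star_single, MonoidAlgebra.single_mul_single, inv_mul_cancel,
        ← mul_one (star c * c), ← smul_eq_mul (star c * c), ← MonoidAlgebra.smul_single,
        ← MonoidAlgebra.one_def, map_smul_eq_mul, norm_mul, norm_star] at h2
      have h3 := p.nonneg (single s c)
      have h4 := norm_nonneg c
      by_contra! hlt
      change ‖c‖ < p (single s c) at hlt
      nlinarith [mul_nonneg h4 h4]

variable (G)

/-- The full group C*-algebra `C*(G)` of the discrete group `G`. -/
def GroupCStar : Type v := EnvelopingCStar (MonoidAlgebra ℂ G)

instance : NonUnitalCStarAlgebra (GroupCStar G) :=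
  inferInstanceAs (NonUnitalCStarAlgebra (EnvelopingCStar (MonoidAlgebra ℂ G)))

/-- The canonical *-homomorphism of the group algebra into `C*(G)`. -/
def GroupCStar.of : MonoidAlgebra ℂ G →⋆ₙₐ[ℂ] GroupCStar G :=
  EnvelopingCStar.of (L := MonoidAlgebra ℂ G)

variable {G}

/-- The canonical unitary of `C*(G)` attached to `s : G`. -/
def GroupCStar.unitary (s : G) : GroupCStar G := GroupCStar.of G (single s 1)

end GroupCStar

/-! ### Partial actions -/

/-- A partial action of the discrete group `G` on the C*-algebra `A`: closed two-sided ideals `D s`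
of `A` (closed ideals of C*-algebras are automatically self-adjoint) and *-isomorphisms
`α s : D s⁻¹ → D s` such that `D 1 = A` and `α (s * t)` extends `α s ∘ α t`, whose domain is
`{x ∈ D t⁻¹ | α t x ∈ D s⁻¹}`. -/
structure PartialAction (G : Type v) [Group G] (A : Type u) [NonUnitalCStarAlgebra A] where
  D : G → NonUnitalStarSubalgebra ℂ A
  isClosed : ∀ s, IsClosed (D s : Set A)
  mul_mem_left : ∀ (s : G) (a : A) {x : A}, x ∈ D s → a * x ∈ D s
  mul_mem_right : ∀ (s : G) (a : A) {x : A}, x ∈ D s → x * a ∈ D s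
  α : ∀ s : G, D s⁻¹ ≃⋆ₐ[ℂ] D s
  D_one : D 1 = ⊤
  extends_comp : ∀ (s t : G) (x : D t⁻¹) (h : (α t x : A) ∈ D s⁻¹),
    ∃ h' : (x : A) ∈ D (s * t)⁻¹, (α (s * t) ⟨x, h'⟩ : A) = α s ⟨α t x, h⟩

namespace PartialAction

variable {G : Type v} [Group G] {A : Type u} [NonUnitalCStarAlgebra A] (θ : PartialAction G A)

/-- `θ.Maps s a b` says that `a` is in the domain of `α s`, with value `b`. -/
def Maps (s : G) (a b : A) : Prop := ∃ h : a ∈ θ.D s⁻¹, (θ.α s ⟨a, h⟩ : A) = b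

variable {θ}

theorem Maps.mem {s : G} {a b : A} (h : θ.Maps s a b) : b ∈ θ.D s := by
  obtain ⟨ha, rfl⟩ := h
  exact (θ.α s ⟨a, ha⟩).2

theorem Maps.mem' {s : G} {a b : A} (h : θ.Maps s a b) : a ∈ θ.D s⁻¹ := h.1

theorem maps_apply (s : G) (a : θ.D s⁻¹) : θ.Maps s a (θ.α s a) := ⟨a.2, rfl⟩

theorem maps_symm (s : G) (a : θ.D s) : θ.Maps s ((θ.α s).symm a) a :=
  ⟨((θ.α s).symm a).2, by simp⟩

theorem exists_maps {s : G} {a : A} (ha : a ∈ θ.D s⁻¹) : ∃ b, θ.Maps s a b :=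
  ⟨_, maps_apply s ⟨a, ha⟩⟩

theorem exists_maps_symm {s : G} {a : A} (ha : a ∈ θ.D s) : ∃ a', θ.Maps s a' a :=
  ⟨_, maps_symm s ⟨a, ha⟩⟩

theorem Maps.eq {s : G} {a b b' : A} (h : θ.Maps s a b) (h' : θ.Maps s a b') : b = b' := by
  obtain ⟨_, rfl⟩ := h
  obtain ⟨_, rfl⟩ := h'
  rfl

theorem Maps.comp {s t : G} {a b c : A} (h : θ.Maps t a b) (h' : θ.Maps s b c) :
    θ.Maps (s * t) a c := by
  obtain ⟨ha, rfl⟩ := h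
  obtain ⟨hb, rfl⟩ := h'
  exact θ.extends_comp s t ⟨a, ha⟩ hb

theorem Maps.inj {s : G} {a a' b : A} (h : θ.Maps s a b) (h' : θ.Maps s a' b) : a = a' := by
  obtain ⟨ha, rfl⟩ := h
  obtain ⟨ha', h'⟩ := h'
  exact congrArg Subtype.val ((θ.α s).injective (Subtype.ext h')).symm

theorem Maps.mul {s : G} {a a' b b' : A} (h : θ.Maps s a b) (h' : θ.Maps s a' b') :
    θ.Maps s (a * a') (b * b') := by
  obtain ⟨ha, rfl⟩ := h
  obtain ⟨ha', rfl⟩ := h'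
  exact ⟨mul_mem ha ha', congrArg Subtype.val (map_mul (θ.α s) ⟨a, ha⟩ ⟨a', ha'⟩)⟩

theorem Maps.add {s : G} {a a' b b' : A} (h : θ.Maps s a b) (h' : θ.Maps s a' b') :
    θ.Maps s (a + a') (b + b') := by
  obtain ⟨ha, rfl⟩ := h
  obtain ⟨ha', rfl⟩ := h'
  exact ⟨add_mem ha ha', congrArg Subtype.val (map_add (θ.α s) ⟨a, ha⟩ ⟨a', ha'⟩)⟩

theorem Maps.smul {s : G} {a b : A} (c : ℂ) (h : θ.Maps s a b) : θ.Maps s (c • a) (c • b) := by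
  obtain ⟨ha, rfl⟩ := h
  exact ⟨SMulMemClass.smul_mem c ha, congrArg Subtype.val (map_smul (θ.α s) c ⟨a, ha⟩)⟩

theorem Maps.star {s : G} {a b : A} (h : θ.Maps s a b) : θ.Maps s (star a) (star b) := by
  obtain ⟨ha, rfl⟩ := h
  exact ⟨star_mem ha, congrArg Subtype.val (map_star (θ.α s) ⟨a, ha⟩)⟩

theorem mem_one (a : A) : a ∈ θ.D 1 := by rw [θ.D_one]; trivial

theorem maps_one (a : A) : θ.Maps 1 a a := by
  have ha : a ∈ θ.D (1 : G)⁻¹ := by rw [inv_one]; exact mem_one a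
  have hb : (θ.α 1 ⟨a, ha⟩ : A) ∈ θ.D (1 : G)⁻¹ :=
    (congrArg θ.D (inv_one (G := G))).ge (mem_one _)
  have h₁ := maps_apply (θ := θ) 1 ⟨a, ha⟩
  have h₂ := maps_apply (θ := θ) 1 ⟨_, hb⟩
  have h₃ := h₁.comp h₂
  rw [one_mul] at h₃
  rw [← h₁.eq h₃] at h₂
  have h₄ := h₁.inj h₂
  dsimp only at h₄
  rwa [← h₄] at h₁

theorem Maps.inv {s : G} {a b : A} (h : θ.Maps s a b) : θ.Maps s⁻¹ b a := by
  have hb : b ∈ θ.D s⁻¹⁻¹ := by rw [inv_inv]; exact h.mem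
  have h₁ := maps_apply (θ := θ) s⁻¹ ⟨b, hb⟩
  have h₂ := h.comp h₁
  rw [inv_mul_cancel] at h₂
  rwa [← (maps_one a).eq h₂] at h₁

/-- Left multiplication by `A` on `D t` commutes with right multiplication by `A` transported
through `α t`. -/
theorem Maps.mul_comm_mul {t : G} {x b b' y c w : A} (hb : θ.Maps t b' b)
    (hy : θ.Maps t y (x * b)) (hw : θ.Maps t (b' * c) w) : θ.Maps t (y * c) (x * w) := by
  obtain ⟨q, hq⟩ := exists_maps (θ.mul_mem_right _ c hy.mem')
  have key : ∀ d ∈ θ.D t, d * q = d * (x * w) := by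
    intro d hd
    obtain ⟨d', hd'⟩ := exists_maps_symm hd
    obtain ⟨e, he⟩ := exists_maps_symm (θ.mul_mem_right _ x hd)
    have h₁ := hd'.mul hy
    have h₂ := he.mul hb
    rw [mul_assoc d x b] at h₂
    have h₃ := h₁.inj h₂
    have h₄ := hd'.mul hq
    have h₅ := he.mul hw
    rw [← mul_assoc, ← h₃, mul_assoc d' y c] at h₅
    rw [h₄.eq h₅, mul_assoc]
  have hmem : q - x * w ∈ θ.D t := sub_mem hq.mem (θ.mul_mem_left _ x hw.mem)
  have h0 : Star.star (q - x * w) * (q - x * w) = 0 := by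
    rw [mul_sub, key _ (star_mem hmem), sub_self]
  rw [CStarRing.star_mul_self_eq_zero_iff, sub_eq_zero] at h0
  rwa [h0] at hq

variable (θ)

/-! ### The *-algebra of finitely supported sections -/

theorem mulCoeff_aux (s t : G) (a : θ.D s) (b : θ.D t) :
    ((θ.α s).symm a : A) * b ∈ θ.D s⁻¹ :=
  θ.mul_mem_right _ _ ((θ.α s).symm a).2

theorem mulCoeff_mem (s t : G) (a : θ.D s) (b : θ.D t) :
    (θ.α s ⟨((θ.α s).symm a : A) * b, θ.mulCoeff_aux s t a b⟩ : A) ∈ θ.D (s * t) := by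
  have h₁ := maps_apply s ⟨((θ.α s).symm a : A) * b, θ.mulCoeff_aux s t a b⟩
  have h₂ := maps_symm t ⟨((θ.α s).symm a : A) * b, θ.mul_mem_left t _ b.2⟩
  exact (h₂.comp h₁).mem

/-- `α s (α s⁻¹ (a) b)`, the coefficient of the product of `F(a,s)` and `F(b,t)`. -/
def mulCoeff (s t : G) (a : θ.D s) (b : θ.D t) : θ.D (s * t) :=
  ⟨θ.α s ⟨((θ.α s).symm a : A) * b, θ.mulCoeff_aux s t a b⟩, θ.mulCoeff_mem s t a b⟩

variable {θ}

theorem Maps.mulCoeff {s t : G} {a : θ.D s} {b : θ.D t} {a' : A} (h : θ.Maps s a' a) :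
    θ.Maps s (a' * b) (θ.mulCoeff s t a b) := by
  rw [h.inj (maps_symm s a)]
  exact maps_apply s ⟨((θ.α s).symm a : A) * b, θ.mulCoeff_aux s t a b⟩

variable (θ)

/-- The product of sections supported at `s` and at `t`, as a bilinear map. -/
def mulCoeffₗ (s t : G) : θ.D s →ₗ[ℂ] θ.D t →ₗ[ℂ] θ.D (s * t) :=
  LinearMap.mk₂ ℂ (θ.mulCoeff s t)
    (fun a a' b => Subtype.ext <| by
      have h := ((maps_symm s a).add (maps_symm s a')).mulCoeff (a := a + a') (b := b)
      rw [add_mul] at h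
      exact h.eq ((maps_symm s a).mulCoeff.add (maps_symm s a').mulCoeff))
    (fun c a b => Subtype.ext <| by
      have h := ((maps_symm s a).smul c).mulCoeff (a := c • a) (b := b)
      rw [smul_mul_assoc] at h
      exact h.eq ((maps_symm s a).mulCoeff.smul c))
    (fun a b b' => Subtype.ext <| by
      have h := (maps_symm s a).mulCoeff (b := b + b')
      rw [NonUnitalStarSubalgebra.coe_add, mul_add] at h
      exact h.eq ((maps_symm s a).mulCoeff.add (maps_symm s a).mulCoeff))
    (fun c a b => Subtype.ext <| by
      have h := (maps_symm s a).mulCoeff (b := c • b)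
      rw [NonUnitalStarSubalgebra.coe_smul, mul_smul_comm] at h
      exact h.eq ((maps_symm s a).mulCoeff.smul c))

/-- The coefficient `α s⁻¹ (a*)` of `F(a,s)*`. -/
def starCoeff (s : G) : θ.D s →+ θ.D s⁻¹ where
  toFun a := (θ.α s).symm (star a)
  map_zero' := by simp
  map_add' a b := by simp

theorem maps_starCoeff (s : G) (a : θ.D s) : θ.Maps s (θ.starCoeff s a) (star (a : A)) :=
  maps_symm s (star a)

open scoped Classical in
/-- The vector space `L_c` of finitely supported functions `f : G → A` with `f s ∈ D s`. -/
def Sections : Type (max u v) := DirectSum G fun s => θ.D s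

namespace Sections

instance : AddCommGroup θ.Sections := inferInstanceAs (AddCommGroup (DirectSum G fun s => θ.D s))
instance : Module ℂ θ.Sections := inferInstanceAs (Module ℂ (DirectSum G fun s => θ.D s))

open scoped Classical in
/-- `F(a,s)`, the section with the value `a` at `s` and `0` elsewhere. -/
def F (s : G) : θ.D s →ₗ[ℂ] θ.Sections := DirectSum.lof ℂ G (fun s => θ.D s) s

variable {θ}

theorem F_congr {s t : G} (h : s = t) {a : θ.D s} {b : θ.D t} (hab : (a : A) = b) :
    F θ s a = F θ t b := by
  subst h
  rw [Subtype.ext hab]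

theorem induction {P : θ.Sections → Prop} (f : θ.Sections) (h0 : P 0)
    (hF : ∀ s a, P (F θ s a)) (hadd : ∀ f g, P f → P g → P (f + g)) : P f := by
  classical
  exact DirectSum.induction_on f h0 hF hadd

open scoped Classical in
/-- The linear map on `L_c` with prescribed values on the sections `F(a,s)`. -/
def lift {M : Type*} [AddCommGroup M] [Module ℂ M] (φ : ∀ s, θ.D s →ₗ[ℂ] M) :
    θ.Sections →ₗ[ℂ] M :=
  DirectSum.toModule ℂ G M φ

theorem lift_F {M : Type*} [AddCommGroup M] [Module ℂ M] (φ : ∀ s, θ.D s →ₗ[ℂ] M) (s : G)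
    (a : θ.D s) : lift φ (F θ s a) = φ s a := by
  classical
  exact DirectSum.toModule_lof (M := fun s => θ.D s) (φ := φ) ℂ s a

variable (θ)

/-- The multiplication of `L_c`, determined by `F(a,s) F(b,t) = F(α s (α s⁻¹ (a) b), s t)`. -/
def mulₗ : θ.Sections →ₗ[ℂ] θ.Sections →ₗ[ℂ] θ.Sections :=
  lift fun s => LinearMap.flip <| lift fun t => ((θ.mulCoeffₗ s t).compr₂ (F θ (s * t))).flip

instance : Mul θ.Sections := ⟨fun f g => mulₗ θ f g⟩

theorem F_mul_F (s t : G) (a : θ.D s) (b : θ.D t) :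
    F θ s a * F θ t b = F θ (s * t) (θ.mulCoeff s t a b) := by
  change mulₗ θ (F θ s a) (F θ t b) = _
  rw [mulₗ, lift_F, LinearMap.flip_apply, lift_F]
  rfl

instance : NonUnitalRing θ.Sections where
  __ := (inferInstance : AddCommGroup θ.Sections)
  left_distrib f g h := map_add (mulₗ θ f) g h
  right_distrib f g h := LinearMap.map_add₂ (mulₗ θ) f g h
  zero_mul f := LinearMap.map_zero₂ (mulₗ θ) f
  mul_zero f := map_zero (mulₗ θ f)
  mul_assoc f g h := by
    have hl : ∀ f g h : θ.Sections, (f + g) * h = f * h + g * h := LinearMap.map_add₂ (mulₗ θ)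
    have hr : ∀ f g h : θ.Sections, f * (g + h) = f * g + f * h := fun f => map_add (mulₗ θ f)
    have zl : ∀ f : θ.Sections, 0 * f = 0 := LinearMap.map_zero₂ (mulₗ θ)
    have zr : ∀ f : θ.Sections, f * 0 = 0 := fun f => map_zero (mulₗ θ f)
    induction f using Sections.induction with
    | h0 => simp only [zl]
    | hadd f₁ f₂ h₁ h₂ => simp only [hl, h₁, h₂]
    | hF s a =>
    induction g using Sections.induction with
    | h0 => simp only [zl, zr]
    | hadd f₁ f₂ h₁ h₂ => simp only [hl, hr, h₁, h₂]
    | hF t b =>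
    induction h using Sections.induction with
    | h0 => simp only [zr]
    | hadd f₁ f₂ h₁ h₂ => simp only [hr, h₁, h₂]
    | hF r c =>
    simp only [F_mul_F]
    refine F_congr (mul_assoc s t r) ?_
    obtain ⟨a', ha⟩ := exists_maps_symm a.2
    obtain ⟨b', hb⟩ := exists_maps_symm b.2
    obtain ⟨y, hy⟩ := exists_maps_symm (θ.mul_mem_left t a' b.2)
    have h₁ := (hy.comp ha.mulCoeff).mulCoeff (b := c)
    have h₂ := (hb.mul_comm_mul hy (hb.mulCoeff (b := c))).comp ha.mulCoeff
    exact h₁.eq h₂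

instance : IsScalarTower ℂ θ.Sections θ.Sections where
  smul_assoc c f g := LinearMap.map_smul₂ (mulₗ θ) c f g

instance : SMulCommClass ℂ θ.Sections θ.Sections where
  smul_comm c f g := (map_smul (mulₗ θ f) c g).symm

open scoped Classical in
/-- The involution of `L_c`, determined by `F(a,s)* = F(α s⁻¹ (a*), s⁻¹)`. -/
def starHom : θ.Sections →+ θ.Sections :=
  DirectSum.toAddMonoid fun s => (F θ s⁻¹).toAddMonoidHom.comp (θ.starCoeff s)

instance : Star θ.Sections := ⟨starHom θ⟩

theorem star_F (s : G) (a : θ.D s) : star (F θ s a) = F θ s⁻¹ (θ.starCoeff s a) := by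
  classical
  exact DirectSum.toAddMonoid_of
    (fun s => (F θ s⁻¹).toAddMonoidHom.comp (θ.starCoeff s)) s a

instance : StarRing θ.Sections where
  star_add := map_add (starHom θ)
  star_involutive f := by
    have hs : ∀ f g : θ.Sections, star (f + g) = star f + star g := map_add (starHom θ)
    have h0 : star (0 : θ.Sections) = 0 := map_zero (starHom θ)
    induction f using Sections.induction with
    | h0 => rw [h0, h0]
    | hadd f₁ f₂ h₁ h₂ => rw [hs, hs, h₁, h₂]
    | hF s a =>
      rw [star_F, star_F]
      refine F_congr (inv_inv s) ?_
      have h₁ := (θ.maps_starCoeff s a).star.inv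
      rw [star_star] at h₁
      exact (θ.maps_starCoeff _ _).inj h₁
  star_mul f g := by
    have hs : ∀ f g : θ.Sections, star (f + g) = star f + star g := map_add (starHom θ)
    have h0 : star (0 : θ.Sections) = 0 := map_zero (starHom θ)
    induction f using Sections.induction with
    | h0 => rw [zero_mul, h0, mul_zero]
    | hadd f₁ f₂ h₁ h₂ => rw [add_mul, hs, h₁, h₂, hs, mul_add]
    | hF s a =>
    induction g using Sections.induction with
    | h0 => rw [mul_zero, h0, zero_mul]
    | hadd f₁ f₂ h₁ h₂ => rw [mul_add, hs, h₁, h₂, hs, add_mul]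
    | hF t b =>
      simp only [F_mul_F, star_F]
      refine F_congr (mul_inv_rev s t) ?_
      have ha := (θ.maps_starCoeff s a).star
      rw [star_star] at ha
      have hb := (θ.maps_starCoeff t b).inv
      have h₁ := (hb.mulCoeff (b := θ.starCoeff s a)).inv
      rw [inv_inv] at h₁
      have h₂ := (ha.mulCoeff (b := b)).star
      rw [star_mul, star_star] at h₂
      exact (θ.maps_starCoeff _ _).inj (h₁.comp h₂)

instance : StarModule ℂ θ.Sections where
  star_smul c f := by
    induction f using Sections.induction with
    | h0 => simp
    | hadd f₁ f₂ h₁ h₂ => rw [smul_add, star_add, h₁, h₂, star_add, smul_add]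
    | hF s a =>
      rw [← map_smul, star_F, star_F, ← map_smul]
      refine F_congr rfl ?_
      have h₁ := (θ.maps_starCoeff s a).smul (star c)
      rw [← star_smul] at h₁
      exact (θ.maps_starCoeff s (c • a)).inj h₁

/-- The inclusion `a ↦ F(a,e)` of `A` in `L_c`. -/
def incl : A →⋆ₙₐ[ℂ] θ.Sections where
  toFun a := F θ 1 ⟨a, mem_one a⟩
  map_smul' c a := by rw [MonoidHom.id_apply, ← map_smul]; rfl
  map_zero' := map_zero (F θ 1)
  map_add' a b := by rw [← map_add]; rfl
  map_mul' a b := by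
    rw [F_mul_F]
    refine F_congr (one_mul 1).symm ?_
    exact (maps_one (a * b)).eq
      ((maps_one a).mulCoeff (a := ⟨a, mem_one a⟩) (b := (⟨b, mem_one b⟩ : θ.D 1)))
  map_star' a := by
    rw [star_F]
    refine F_congr inv_one.symm ?_
    exact (maps_one (star a)).inj (θ.maps_starCoeff 1 ⟨a, mem_one a⟩)

/-- Every element of `L_c` has bounded C*-seminorms. -/
instance : IsCStarBounded θ.Sections where
  bddAbove f := by
    induction f using Sections.induction with
    | h0 => exact ⟨0, by rintro _ ⟨p, rfl⟩; simp⟩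
    | hadd f₁ f₂ h₁ h₂ =>
      obtain ⟨c₁, h₁⟩ := h₁
      obtain ⟨c₂, h₂⟩ := h₂
      refine ⟨c₁ + c₂, ?_⟩
      rintro _ ⟨p, rfl⟩
      exact (map_add_le_add p.toSeminorm f₁ f₂).trans
        (add_le_add (h₁ ⟨p, rfl⟩) (h₂ ⟨p, rfl⟩))
    | hF s a =>
      obtain ⟨m, hm⟩ : ∃ m, star (F θ s a) * F θ s a = incl θ m := by
        refine ⟨θ.mulCoeff s⁻¹ s (θ.starCoeff s a) a, ?_⟩
        rw [star_F, F_mul_F]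
        exact F_congr (inv_mul_cancel s) rfl
      refine ⟨Real.sqrt ‖m‖, ?_⟩
      rintro _ ⟨p, rfl⟩
      refine Real.le_sqrt_of_sq_le ?_
      rw [sq, ← p.star_mul_self, hm, ← p.norm_toCompletion]
      exact NonUnitalStarAlgHom.norm_apply_le (p.toCompletion.comp (incl θ)) m

end Sections

/-! ### The crossed product -/

/-- The partial crossed product `A ⋊ G`: the C*-completion of `L_c` in its greatest
C*-seminorm. -/
def CrossedProduct : Type (max u v) := EnvelopingCStar θ.Sections

instance : NonUnitalCStarAlgebra θ.CrossedProduct :=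
  inferInstanceAs (NonUnitalCStarAlgebra (EnvelopingCStar θ.Sections))

/-- The canonical *-homomorphism of `L_c` into the crossed product. -/
def ofSections : θ.Sections →⋆ₙₐ[ℂ] θ.CrossedProduct := EnvelopingCStar.of (L := θ.Sections)

/-- The canonical map of `A` into the crossed product. -/
def ι : A →⋆ₙₐ[ℂ] θ.CrossedProduct := θ.ofSections.comp (Sections.incl θ)

/-- `F(a,s)` as an element of the crossed product. -/
def F (s : G) (a : θ.D s) : θ.CrossedProduct := θ.ofSections (Sections.F θ s a)

/-- The subspace `X s = {F(a,s) | a ∈ D s}` of the crossed product, a `D s`-`D s⁻¹` imprimitivity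
bimodule under multiplication in the crossed product. -/
def X (s : G) : Submodule ℂ θ.CrossedProduct :=
  LinearMap.range
    ((θ.ofSections : θ.Sections →ₗ[ℂ] θ.CrossedProduct) ∘ₗ Sections.F θ s)

/-- A multiplier of the `D s`-`D s⁻¹` bimodule `X s`: a pair of module maps `D s → X s` and
`D s⁻¹ → X s`, written `c ↦ c · m` and `d ↦ m · d`, such that `(c · m) d = c (m · d)`. -/
structure BimoduleMultiplier (s : G) where
  left : θ.D s →ₗ[ℂ] θ.X s
  right : θ.D s⁻¹ →ₗ[ℂ] θ.X s
  left_mul : ∀ c c' : θ.D s, (left (c' * c) : θ.CrossedProduct) = θ.ι c' * left c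
  right_mul : ∀ d d' : θ.D s⁻¹, (right (d * d') : θ.CrossedProduct) = right d * θ.ι d'
  compat : ∀ (c : θ.D s) (d : θ.D s⁻¹),
    (left c : θ.CrossedProduct) * θ.ι d = θ.ι c * right d

theorem F_mem_X (s : G) (a : θ.D s) : θ.F s a ∈ θ.X s := ⟨a, rfl⟩

/-- `a ↦ F(a,s)` as a linear map of `D s` into `X s`. -/
def toX (s : G) : θ.D s →ₗ[ℂ] θ.X s where
  toFun a := ⟨θ.F s a, θ.F_mem_X s a⟩
  map_add' a b := Subtype.ext <| by simp [F]
  map_smul' c a := Subtype.ext <| by simp [F]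

theorem ι_mul_F (s : G) (c : A) (a b : θ.D s) (h : (b : A) = c * a) :
    θ.ι c * θ.F s a = θ.F s b := by
  change θ.ofSections (Sections.F θ 1 ⟨c, mem_one c⟩) * θ.ofSections _ = _
  rw [← map_mul, Sections.F_mul_F]
  refine congrArg _ (Sections.F_congr (one_mul s) ?_)
  rw [h]
  exact ((maps_one c).mulCoeff (a := ⟨c, mem_one c⟩) (b := a)).eq (maps_one (c * a))

theorem F_mul_ι (s : G) (a b : θ.D s) (d a' : A) (ha : θ.Maps s a' a) (hb : θ.Maps s (a' * d) b) :
    θ.F s a * θ.ι d = θ.F s b := by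
  change θ.ofSections _ * θ.ofSections (Sections.F θ 1 ⟨d, mem_one d⟩) = _
  rw [← map_mul, Sections.F_mul_F]
  refine congrArg _ (Sections.F_congr (mul_one s) ?_)
  exact (ha.mulCoeff (b := (⟨d, mem_one d⟩ : θ.D 1))).eq hb

/-- The multiplier `m s` of `X s`, given by `a · m s = F(a,s)` and `m s · b = F(α s (b),s)`. -/
def m (s : G) : θ.BimoduleMultiplier s where
  left := θ.toX s
  right := θ.toX s ∘ₗ (θ.α s : θ.D s⁻¹ →ₗ[ℂ] θ.D s)
  left_mul c c' := (θ.ι_mul_F s c' c (c' * c) rfl).symm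
  right_mul d d' := (θ.F_mul_ι s (θ.α s d) (θ.α s (d * d')) d' d (maps_apply s d)
    (maps_apply s (d * d'))).symm
  compat c d := by
    have hc := maps_symm s c
    have hd := maps_apply s d
    have h := hc.mul hd
    exact (θ.F_mul_ι s c (c * θ.α s d) d _ hc h).trans
      (θ.ι_mul_F s c (θ.α s d) (c * θ.α s d) rfl).symm

end PartialAction

/-! ### The minimal (spatial) tensor product of C*-algebras -/

section TensorAlgebra

variable {B C : Type*} [NonUnitalRing B] [StarRing B] [Module ℂ B] [IsScalarTower ℂ B B]
  [SMulCommClass ℂ B B] [StarModule ℂ B] [NonUnitalRing C] [StarRing C] [Module ℂ C]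
  [IsScalarTower ℂ C C] [SMulCommClass ℂ C C] [StarModule ℂ C]

instance : StarRing (B ⊗[ℂ] C) where
  __ := (inferInstance : StarAddMonoid (B ⊗[ℂ] C))
  star_mul x y := by
    induction x using TensorProduct.induction_on with
    | zero => simp
    | add x₁ x₂ h₁ h₂ => rw [add_mul, star_add, h₁, h₂, star_add, mul_add]
    | tmul b c =>
      induction y using TensorProduct.induction_on with
      | zero => simp
      | add x₁ x₂ h₁ h₂ => rw [mul_add, star_add, h₁, h₂, star_add, add_mul]
      | tmul b' c' => simp [Algebra.TensorProduct.tmul_mul_tmul, star_mul]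

/-- A linear map on `B ⊗ C` which respects products and adjoints of elementary tensors is a
*-homomorphism. -/
def tensorStarHom {X : Type*} [NonUnitalRing X] [StarRing X] [Module ℂ X]
    (f : B ⊗[ℂ] C →ₗ[ℂ] X)
    (hmul : ∀ b c b' c', f ((b * b') ⊗ₜ (c * c')) = f (b ⊗ₜ c) * f (b' ⊗ₜ c'))
    (hstar : ∀ b c, f (star b ⊗ₜ star c) = star (f (b ⊗ₜ c))) : B ⊗[ℂ] C →⋆ₙₐ[ℂ] X where
  __ := f
  map_zero' := map_zero f
  map_mul' x y := by
    change f (x * y) = f x * f y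
    induction x using TensorProduct.induction_on with
    | zero => simp
    | add x₁ x₂ h₁ h₂ => rw [add_mul, map_add, h₁, h₂, map_add, add_mul]
    | tmul b c =>
      induction y using TensorProduct.induction_on with
      | zero => simp
      | add x₁ x₂ h₁ h₂ => rw [mul_add, map_add, h₁, h₂, map_add, mul_add]
      | tmul b' c' => rw [Algebra.TensorProduct.tmul_mul_tmul, hmul]
  map_star' x := by
    change f (star x) = star (f x)
    induction x using TensorProduct.induction_on with
    | zero => simp
    | add x₁ x₂ h₁ h₂ => rw [star_add, map_add, h₁, h₂, map_add, star_add]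
    | tmul b c => rw [TensorProduct.star_tmul, hstar]

/-- The algebraic tensor product of two *-homomorphisms. -/
def tensorMapHom {B' C' : Type*} [NonUnitalRing B'] [StarRing B'] [Module ℂ B']
    [IsScalarTower ℂ B' B'] [SMulCommClass ℂ B' B'] [StarModule ℂ B'] [NonUnitalRing C']
    [StarRing C'] [Module ℂ C'] [IsScalarTower ℂ C' C'] [SMulCommClass ℂ C' C'] [StarModule ℂ C']
    (φ : B →⋆ₙₐ[ℂ] B') (ψ : C →⋆ₙₐ[ℂ] C') : B ⊗[ℂ] C →⋆ₙₐ[ℂ] B' ⊗[ℂ] C' :=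
  tensorStarHom (TensorProduct.map (φ : B →ₗ[ℂ] B') (ψ : C →ₗ[ℂ] C'))
    (fun b c b' c' => by simp [Algebra.TensorProduct.tmul_mul_tmul])
    (fun b c => by simp [map_star])

theorem tensorMapHom_tmul {B' C' : Type*} [NonUnitalRing B'] [StarRing B'] [Module ℂ B']
    [IsScalarTower ℂ B' B'] [SMulCommClass ℂ B' B'] [StarModule ℂ B'] [NonUnitalRing C']
    [StarRing C'] [Module ℂ C'] [IsScalarTower ℂ C' C'] [SMulCommClass ℂ C' C'] [StarModule ℂ C']
    (φ : B →⋆ₙₐ[ℂ] B') (ψ : C →⋆ₙₐ[ℂ] C') (b : B) (c : C) :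
    tensorMapHom φ ψ (b ⊗ₜ c) = φ b ⊗ₜ ψ c := rfl

/-- The associativity isomorphism of algebraic tensor products, as a *-homomorphism. -/
def tensorAssocHom {D : Type*} [NonUnitalRing D] [StarRing D] [Module ℂ D] [IsScalarTower ℂ D D]
    [SMulCommClass ℂ D D] [StarModule ℂ D] :
    (B ⊗[ℂ] C) ⊗[ℂ] D →⋆ₙₐ[ℂ] B ⊗[ℂ] (C ⊗[ℂ] D) :=
  tensorStarHom (B := B ⊗[ℂ] C) (C := D) (X := B ⊗[ℂ] (C ⊗[ℂ] D))
    (TensorProduct.assoc ℂ B C D).toLinearMap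
    (fun x d x' d' => by
      induction x using TensorProduct.induction_on with
      | zero => simp
      | add x₁ x₂ h₁ h₂ =>
        rw [add_mul, TensorProduct.add_tmul, map_add, h₁, h₂, TensorProduct.add_tmul, map_add,
          add_mul]
      | tmul b c =>
        induction x' using TensorProduct.induction_on with
        | zero => simp
        | add x₁ x₂ h₁ h₂ =>
          rw [mul_add, TensorProduct.add_tmul, map_add, h₁, h₂, TensorProduct.add_tmul, map_add,
            mul_add]
        | tmul b' c' => simp [Algebra.TensorProduct.tmul_mul_tmul])
    (fun x d => by
      induction x using TensorProduct.induction_on with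
      | zero => simp
      | add x₁ x₂ h₁ h₂ =>
        rw [star_add, TensorProduct.add_tmul, map_add, h₁, h₂, TensorProduct.add_tmul, map_add,
          star_add]
      | tmul b c => simp)

theorem tensorAssocHom_tmul {D : Type*} [NonUnitalRing D] [StarRing D] [Module ℂ D]
    [IsScalarTower ℂ D D] [SMulCommClass ℂ D D] [StarModule ℂ D] (b : B) (c : C) (d : D) :
    tensorAssocHom ((b ⊗ₜ[ℂ] c) ⊗ₜ[ℂ] d) = b ⊗ₜ[ℂ] (c ⊗ₜ[ℂ] d) := rfl

end TensorAlgebra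

/-- A *-representation of a *-algebra by bounded operators on a (not necessarily complete) inner
product space. -/
structure PreRep (L : Type*) [NonUnitalRing L] [StarRing L] [Module ℂ L] (E : Type*)
    [NormedAddCommGroup E] [InnerProductSpace ℂ E] where
  toHom : L →ₙₐ[ℂ] (E →L[ℂ] E)
  adjoint : ∀ (x : L) (ξ η : E), inner ℂ (toHom x ξ) η = inner ℂ ξ (toHom (star x) η)

namespace PreRep

section

variable {E F : Type*} [NormedAddCommGroup E] [InnerProductSpace ℂ E] [NormedAddCommGroup F]
  [InnerProductSpace ℂ F]

open UniformSpace in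
/-- The *-representation on the Hilbert space completion. -/
def completion {L : Type*} [NonUnitalRing L] [StarRing L] [Module ℂ L] (P : PreRep L E) :
    L →⋆ₙₐ[ℂ] (Completion E →L[ℂ] Completion E) where
  toFun x := (P.toHom x).completion
  map_smul' c x := by
    ext z
    induction z using Completion.induction_on with
    | hp => exact isClosed_eq (ContinuousLinearMap.continuous _) (ContinuousLinearMap.continuous _)
    | ih z => simp [Completion.coe_smul]
  map_zero' := by
    ext z
    induction z using Completion.induction_on with
    | hp => exact isClosed_eq (ContinuousLinearMap.continuous _) (ContinuousLinearMap.continuous _)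
    | ih z => simp
  map_add' x y := by
    ext z
    induction z using Completion.induction_on with
    | hp => exact isClosed_eq (ContinuousLinearMap.continuous _) (ContinuousLinearMap.continuous _)
    | ih z => simp [Completion.coe_add]
  map_mul' x y := by
    ext z
    induction z using Completion.induction_on with
    | hp => exact isClosed_eq (ContinuousLinearMap.continuous _) (ContinuousLinearMap.continuous _)
    | ih z => simp
  map_star' x := by
    refine (ContinuousLinearMap.eq_adjoint_iff _ _).mpr fun ξ η => ?_
    induction ξ, η using Completion.induction_on₂ with
    | hp => exact isClosed_eq (by fun_prop) (by fun_prop)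
    | ih ξ η =>
      simp only [ContinuousLinearMap.completion_apply_coe, Completion.inner_coe]
      rw [P.adjoint, star_star]

open UniformSpace in
theorem completion_coe {L : Type*} [NonUnitalRing L] [StarRing L] [Module ℂ L] (P : PreRep L E)
    (x : L) (ξ : E) : P.completion x (ξ : Completion E) = (P.toHom x ξ : E) :=
  ContinuousLinearMap.completion_apply_coe _ ξ

open UniformSpace in
theorem norm_completion {L : Type*} [NonUnitalRing L] [StarRing L] [Module ℂ L] (P : PreRep L E)
    (x : L) : ‖P.completion x‖ = ‖P.toHom x‖ := by
  apply le_antisymm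
  · refine ContinuousLinearMap.opNorm_le_bound _ (norm_nonneg _) fun ξ => ?_
    induction ξ using Completion.induction_on with
    | hp => exact isClosed_le (by fun_prop) (by fun_prop)
    | ih ξ =>
      rw [completion_coe, Completion.norm_coe, Completion.norm_coe]
      exact ContinuousLinearMap.le_opNorm _ _
  · refine ContinuousLinearMap.opNorm_le_bound _ (norm_nonneg _) fun ξ => ?_
    rw [← Completion.norm_coe, ← completion_coe, ← Completion.norm_coe ξ]
    exact ContinuousLinearMap.le_opNorm _ _

/-- The C*-seminorm `x ↦ ‖P x‖` of a representation, the norm being that of the operator on the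
Hilbert space completion. -/
def seminorm {L : Type*} [NonUnitalRing L] [StarRing L] [Module ℂ L] (P : PreRep L E) :
    CStarSeminorm L :=
  CStarSeminorm.ofHom
    (B := UniformSpace.Completion E →L[ℂ] UniformSpace.Completion E) P.completion

theorem seminorm_apply {L : Type*} [NonUnitalRing L] [StarRing L] [Module ℂ L] (P : PreRep L E)
    (x : L) : P.seminorm x = ‖P.toHom x‖ :=
  P.norm_completion x

/-- The extension of a representation to the completion in a C*-seminorm. -/
def extend {L : Type*} [NonUnitalRing L] [StarRing L] [Module ℂ L] [IsScalarTower ℂ L L]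
    [SMulCommClass ℂ L L] [StarModule ℂ L] (P : PreRep L E) (p : CStarSeminorm L)
    (h : ∀ x, P.seminorm x ≤ p x) :
    p.Completion →⋆ₙₐ[ℂ] (UniformSpace.Completion E →L[ℂ] UniformSpace.Completion E) :=
  p.lift (B := UniformSpace.Completion E →L[ℂ] UniformSpace.Completion E) P.completion h

theorem extend_coe {L : Type*} [NonUnitalRing L] [StarRing L] [Module ℂ L] [IsScalarTower ℂ L L]
    [SMulCommClass ℂ L L] [StarModule ℂ L] (P : PreRep L E) (p : CStarSeminorm L)
    (h : ∀ x, P.seminorm x ≤ p x) (x : L) (ξ : E) :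
    P.extend p h (p.toCompletion x) (ξ : UniformSpace.Completion E) =
      ((P.toHom x ξ : E) : UniformSpace.Completion E) := by
  rw [← completion_coe]
  exact congrArg (fun T : UniformSpace.Completion E →L[ℂ] UniformSpace.Completion E => T ξ)
    (p.lift_coe (B := UniformSpace.Completion E →L[ℂ] UniformSpace.Completion E) P.completion h x)

/-- Operators intertwined by an isometry. -/
theorem norm_le_of_intertwine (V : E →ₗᵢ[ℂ] F) (S : E →L[ℂ] E) (T : F →L[ℂ] F)
    (h : ∀ ξ, V (S ξ) = T (V ξ)) : ‖S‖ ≤ ‖T‖ := by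
  refine ContinuousLinearMap.opNorm_le_bound _ (norm_nonneg _) fun ξ => ?_
  rw [← V.norm_map, h, ← V.norm_map ξ]
  exact ContinuousLinearMap.le_opNorm _ _

variable {B C : Type*} [NonUnitalRing B] [StarRing B] [Module ℂ B] [IsScalarTower ℂ B B]
  [SMulCommClass ℂ B B] [StarModule ℂ B] [NonUnitalRing C] [StarRing C] [Module ℂ C]
  [IsScalarTower ℂ C C] [SMulCommClass ℂ C C] [StarModule ℂ C]

/-- The linear map `b ⊗ c ↦ P b ⊗ Q c`. -/
def tensorₗ (P : PreRep B E) (Q : PreRep C F) :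
    B ⊗[ℂ] C →ₗ[ℂ] ((E ⊗[ℂ] F) →L[ℂ] (E ⊗[ℂ] F)) :=
  TensorProduct.lift <| LinearMap.mk₂ ℂ
    (fun b c => TensorProduct.mapL (P.toHom b) (Q.toHom c))
    (fun b b' c => by rw [map_add, TensorProduct.mapL_add_left])
    (fun r b c => by rw [map_smul, TensorProduct.mapL_smul_left])
    (fun b c c' => by rw [map_add, TensorProduct.mapL_add_right])
    (fun r b c => by rw [map_smul, TensorProduct.mapL_smul_right])

theorem tensorₗ_tmul (P : PreRep B E) (Q : PreRep C F) (b : B) (c : C) :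
    tensorₗ P Q (b ⊗ₜ c) = TensorProduct.mapL (P.toHom b) (Q.toHom c) := rfl

/-- The tensor product of two *-representations, acting on the tensor product of the inner product
spaces by `(b ⊗ c) (ξ ⊗ η) = b ξ ⊗ c η`. -/
def tensor (P : PreRep B E) (Q : PreRep C F) : PreRep (B ⊗[ℂ] C) (E ⊗[ℂ] F) where
  toHom :=
    { tensorₗ P Q with
      map_zero' := map_zero (tensorₗ P Q)
      map_mul' := fun x y => by
        change tensorₗ P Q (x * y) = tensorₗ P Q x * tensorₗ P Q y
        induction x using TensorProduct.induction_on with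
        | zero => simp
        | add x₁ x₂ h₁ h₂ => rw [add_mul, map_add, h₁, h₂, map_add, add_mul]
        | tmul b c =>
          induction y using TensorProduct.induction_on with
          | zero => simp
          | add x₁ x₂ h₁ h₂ => rw [mul_add, map_add, h₁, h₂, map_add, mul_add]
          | tmul b' c' =>
            rw [Algebra.TensorProduct.tmul_mul_tmul, tensorₗ_tmul, tensorₗ_tmul, tensorₗ_tmul,
              map_mul, map_mul, TensorProduct.mapL_mul] }
  adjoint x ξ η := by
    change inner ℂ (tensorₗ P Q x ξ) η = inner ℂ ξ (tensorₗ P Q (star x) η)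
    induction x using TensorProduct.induction_on with
    | zero => simp
    | add x₁ x₂ h₁ h₂ =>
      rw [star_add, map_add, map_add, add_apply, add_apply, inner_add_left, inner_add_right, h₁, h₂]
    | tmul b c =>
      rw [TensorProduct.star_tmul, tensorₗ_tmul, tensorₗ_tmul]
      induction ξ using TensorProduct.induction_on with
      | zero => simp
      | add ξ₁ ξ₂ h₁ h₂ => rw [map_add, inner_add_left, inner_add_left, h₁, h₂]
      | tmul e f =>
        induction η using TensorProduct.induction_on with
        | zero => simp
        | add ξ₁ ξ₂ h₁ h₂ => rw [map_add, inner_add_right, inner_add_right, h₁, h₂]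
        | tmul e' f' =>
          rw [TensorProduct.mapL_tmul, TensorProduct.mapL_tmul, TensorProduct.inner_tmul,
            TensorProduct.inner_tmul, P.adjoint, Q.adjoint]

theorem tensor_tmul (P : PreRep B E) (Q : PreRep C F) (b : B) (c : C) :
    (tensor P Q).toHom (b ⊗ₜ c) = TensorProduct.mapL (P.toHom b) (Q.toHom c) := rfl

end

end PreRep

/-- A representation of the C*-algebra `B` on a Hilbert space. The universe of the Hilbert space is
that of `B`, which is large enough for all cyclic representations and for the universal one. -/
structure HilbertRep (B : Type u) [NonUnitalCStarAlgebra B] : Type (u + 1) where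
  H : Type u
  [normedAddCommGroup : NormedAddCommGroup H]
  [innerProductSpace : InnerProductSpace ℂ H]
  [completeSpace : CompleteSpace H]
  π : B →⋆ₙₐ[ℂ] (H →L[ℂ] H)

namespace HilbertRep

attribute [instance] normedAddCommGroup innerProductSpace completeSpace

variable {B : Type u} [NonUnitalCStarAlgebra B]

/-- A representation on a Hilbert space as a representation on an inner product space. -/
def pre (R : HilbertRep B) : PreRep B R.H where
  toHom := (R.π : B →ₙₐ[ℂ] (R.H →L[ℂ] R.H))
  adjoint x ξ η := by
    change inner ℂ (R.π x ξ) η = inner ℂ ξ (R.π (star x) η)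
    rw [map_star, ContinuousLinearMap.star_eq_adjoint, ContinuousLinearMap.adjoint_inner_right]

theorem norm_pre_le (R : HilbertRep B) (b : B) : ‖R.pre.toHom b‖ ≤ ‖b‖ :=
  NonUnitalStarAlgHom.norm_apply_le R.π b

/-- The composition of a representation with a *-homomorphism. -/
abbrev comp {B' : Type u} [NonUnitalCStarAlgebra B'] (R : HilbertRep B') (φ : B →⋆ₙₐ[ℂ] B') :
    HilbertRep B where
  H := R.H
  π := R.π.comp φ

end HilbertRep

section MinTensor

variable (B : Type u) (C : Type v) (D : Type w) [NonUnitalCStarAlgebra B]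
  [NonUnitalCStarAlgebra C] [NonUnitalCStarAlgebra D]

variable {B C D} in
/-- The C*-seminorm `‖(π ⊗ ρ)(x)‖` on `B ⊗ C` of two representations, where `π ⊗ ρ` acts on the
Hilbert space tensor product (the completion of the algebraic one). -/
def repSeminorm (R : HilbertRep B × HilbertRep C) : CStarSeminorm (B ⊗[ℂ] C) :=
  (PreRep.tensor R.1.pre R.2.pre).seminorm

variable {B C D} in
theorem repSeminorm_apply (R : HilbertRep B × HilbertRep C) (x : B ⊗[ℂ] C) :
    repSeminorm R x = ‖(PreRep.tensor R.1.pre R.2.pre).toHom x‖ :=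
  PreRep.seminorm_apply _ x

variable {B C D} in
theorem repSeminorm_tmul_le (R : HilbertRep B × HilbertRep C) (b : B) (c : C) :
    repSeminorm R (b ⊗ₜ c) ≤ ‖b‖ * ‖c‖ := by
  rw [repSeminorm_apply, PreRep.tensor_tmul]
  exact (TensorProduct.norm_mapL_le _ _).trans
    (mul_le_mul (R.1.norm_pre_le b) (R.2.norm_pre_le c) (norm_nonneg _) (norm_nonneg _))

theorem bddAbove_repSeminorm (x : B ⊗[ℂ] C) :
    BddAbove (Set.range fun R : HilbertRep B × HilbertRep C => repSeminorm R x) := by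
  induction x using TensorProduct.induction_on with
  | zero => exact ⟨0, by rintro _ ⟨p, rfl⟩; simp⟩
  | add x₁ x₂ h₁ h₂ =>
    obtain ⟨c₁, h₁⟩ := h₁
    obtain ⟨c₂, h₂⟩ := h₂
    refine ⟨c₁ + c₂, ?_⟩
    rintro _ ⟨R, rfl⟩
    exact (map_add_le_add (repSeminorm R).toSeminorm x₁ x₂).trans
      (add_le_add (h₁ ⟨R, rfl⟩) (h₂ ⟨R, rfl⟩))
  | tmul b c =>
    refine ⟨‖b‖ * ‖c‖, ?_⟩
    rintro _ ⟨R, rfl⟩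
    exact repSeminorm_tmul_le R b c

/-- The minimal (spatial) C*-norm on the algebraic tensor product `B ⊗ C`: the supremum of
`‖(π ⊗ ρ)(x)‖` over all Hilbert space representations `π` of `B` and `ρ` of `C`. -/
def spatialSeminorm : CStarSeminorm (B ⊗[ℂ] C) :=
  CStarSeminorm.sup repSeminorm (bddAbove_repSeminorm B C)

/-- The minimal (spatial) tensor product of the C*-algebras `B` and `C`. -/
def MinTensor : Type (max u v) := (spatialSeminorm B C).Completion

instance : NonUnitalCStarAlgebra (MinTensor B C) :=
  inferInstanceAs (NonUnitalCStarAlgebra (spatialSeminorm B C).Completion)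

/-- The C*-seminorm `‖(π ⊗ ρ ⊗ σ)(x)‖` on `B ⊗ C ⊗ D` of three representations. -/
def repSeminorm₃ (R : HilbertRep B × HilbertRep C × HilbertRep D) :
    CStarSeminorm (B ⊗[ℂ] (C ⊗[ℂ] D)) :=
  (PreRep.tensor R.1.pre (PreRep.tensor R.2.1.pre R.2.2.pre)).seminorm

theorem bddAbove_repSeminorm₃ (x : B ⊗[ℂ] (C ⊗[ℂ] D)) :
    BddAbove (Set.range fun R : HilbertRep B × HilbertRep C × HilbertRep D =>
      repSeminorm₃ B C D R x) := by
  have hadd : ∀ x₁ x₂ : B ⊗[ℂ] (C ⊗[ℂ] D),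
      BddAbove (Set.range fun R => repSeminorm₃ B C D R x₁) →
      BddAbove (Set.range fun R => repSeminorm₃ B C D R x₂) →
      BddAbove (Set.range fun R => repSeminorm₃ B C D R (x₁ + x₂)) := by
    rintro x₁ x₂ ⟨c₁, h₁⟩ ⟨c₂, h₂⟩
    refine ⟨c₁ + c₂, ?_⟩
    rintro _ ⟨R, rfl⟩
    exact (map_add_le_add (repSeminorm₃ B C D R).toSeminorm x₁ x₂).trans
      (add_le_add (h₁ ⟨R, rfl⟩) (h₂ ⟨R, rfl⟩))
  induction x using TensorProduct.induction_on with
  | zero => exact ⟨0, by rintro _ ⟨p, rfl⟩; simp⟩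
  | add x₁ x₂ h₁ h₂ => exact hadd _ _ h₁ h₂
  | tmul b y =>
    induction y using TensorProduct.induction_on with
    | zero => exact ⟨0, by rintro _ ⟨p, rfl⟩; simp⟩
    | add x₁ x₂ h₁ h₂ => rw [TensorProduct.tmul_add]; exact hadd _ _ h₁ h₂
    | tmul c d =>
      refine ⟨‖b‖ * (‖c‖ * ‖d‖), ?_⟩
      rintro _ ⟨R, rfl⟩
      dsimp only
      rw [repSeminorm₃, PreRep.seminorm_apply]
      rw [PreRep.tensor_tmul, PreRep.tensor_tmul]
      refine (TensorProduct.norm_mapL_le _ _).trans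
        (mul_le_mul (R.1.norm_pre_le b) ?_ (norm_nonneg _) (norm_nonneg _))
      exact (TensorProduct.norm_mapL_le _ _).trans
        (mul_le_mul (R.2.1.norm_pre_le c) (R.2.2.norm_pre_le d) (norm_nonneg _) (norm_nonneg _))

/-- The spatial C*-norm on the algebraic tensor product of three C*-algebras. -/
def spatialSeminorm₃ : CStarSeminorm (B ⊗[ℂ] (C ⊗[ℂ] D)) :=
  CStarSeminorm.sup (repSeminorm₃ B C D) (bddAbove_repSeminorm₃ B C D)

/-- The minimal (spatial) tensor product of three C*-algebras. -/
def MinTensor₃ : Type (max u v w) := (spatialSeminorm₃ B C D).Completion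

instance : NonUnitalCStarAlgebra (MinTensor₃ B C D) :=
  inferInstanceAs (NonUnitalCStarAlgebra (spatialSeminorm₃ B C D).Completion)

/-- The canonical *-homomorphism of the algebraic tensor product into the spatial one. -/
def MinTensor₃.of : B ⊗[ℂ] (C ⊗[ℂ] D) →⋆ₙₐ[ℂ] MinTensor₃ B C D :=
  (spatialSeminorm₃ B C D).toCompletion

variable {B C D} in
theorem MinTensor₃.norm_of (x : B ⊗[ℂ] (C ⊗[ℂ] D)) : ‖of B C D x‖ = spatialSeminorm₃ B C D x :=
  (spatialSeminorm₃ B C D).norm_toCompletion x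

namespace MinTensor

/-- The canonical *-homomorphism of the algebraic tensor product into the spatial one. -/
def of : B ⊗[ℂ] C →⋆ₙₐ[ℂ] MinTensor B C := (spatialSeminorm B C).toCompletion

variable {B C D}

theorem norm_of (x : B ⊗[ℂ] C) : ‖of B C x‖ = spatialSeminorm B C x :=
  (spatialSeminorm B C).norm_toCompletion x

theorem denseRange_of : DenseRange (of B C) := (spatialSeminorm B C).denseRange_toCompletion

/-- The elementary tensor `b ⊗ c`. -/
def tmul (b : B) (c : C) : MinTensor B C := of B C (b ⊗ₜ c)

theorem norm_tmul_le (b : B) (c : C) : ‖tmul b c‖ ≤ ‖b‖ * ‖c‖ := by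
  rw [tmul, norm_of]
  exact CStarSeminorm.sup_le _ _ (mul_nonneg (norm_nonneg _) (norm_nonneg _))
    fun R => repSeminorm_tmul_le R b c

/-- The elementary tensors as a continuous bilinear map. -/
def tmulL : B →L[ℂ] C →L[ℂ] MinTensor B C :=
  LinearMap.mkContinuous₂
    (LinearMap.mk₂ ℂ tmul
      (fun b b' c => by simp [tmul, TensorProduct.add_tmul])
      (fun r b c => by rw [tmul, ← TensorProduct.smul_tmul', map_smul, tmul])
      (fun b c c' => by simp [tmul, TensorProduct.tmul_add])
      (fun r b c => by simp [tmul])) 1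
    (fun b c => by rw [one_mul]; exact norm_tmul_le b c)

/-- The tensor product `φ ⊗ ψ : B ⊗ C → B' ⊗ C'` of two *-homomorphisms. -/
def map {B' : Type u} {C' : Type v} [NonUnitalCStarAlgebra B'] [NonUnitalCStarAlgebra C']
    (φ : B →⋆ₙₐ[ℂ] B') (ψ : C →⋆ₙₐ[ℂ] C') : MinTensor B C →⋆ₙₐ[ℂ] MinTensor B' C' :=
  (spatialSeminorm B C).lift ((of B' C').comp (tensorMapHom φ ψ))
    (fun x => by
      rw [NonUnitalStarAlgHom.comp_apply, norm_of]
      refine CStarSeminorm.sup_le _ _ (CStarSeminorm.nonneg _ _) fun R => ?_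
      refine le_trans (le_of_eq ?_)
        (CStarSeminorm.le_sup repSeminorm (bddAbove_repSeminorm B C) (R.1.comp φ, R.2.comp ψ) x)
      rw [repSeminorm_apply, repSeminorm_apply]
      dsimp only
      congr 1
      induction x using TensorProduct.induction_on with
      | zero => simp
      | add x₁ x₂ h₁ h₂ => rw [map_add, map_add, h₁, h₂, map_add]
      | tmul b c => rfl)

theorem map_tmul {B' : Type u} {C' : Type v} [NonUnitalCStarAlgebra B'] [NonUnitalCStarAlgebra C']
    (φ : B →⋆ₙₐ[ℂ] B') (ψ : C →⋆ₙₐ[ℂ] C') (b : B) (c : C) :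
    map φ ψ (tmul b c) = tmul (φ b) (ψ c) :=
  CStarSeminorm.lift_coe (spatialSeminorm B C) ((of B' C').comp (tensorMapHom φ ψ)) _ (b ⊗ₜ c)

/-- The representation `π ⊗ ρ` of the minimal tensor product. -/
def rep (R : HilbertRep B) (S : HilbertRep C) : HilbertRep (MinTensor B C) where
  H := UniformSpace.Completion (R.H ⊗[ℂ] S.H)
  π := (PreRep.tensor R.pre S.pre).extend (spatialSeminorm B C)
    (CStarSeminorm.le_sup repSeminorm (bddAbove_repSeminorm B C) (R, S))

theorem rep_coe (R : HilbertRep B) (S : HilbertRep C) (x : B ⊗[ℂ] C) (ξ : R.H ⊗[ℂ] S.H) :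
    (rep R S).pre.toHom (of B C x)
      (ξ : UniformSpace.Completion (R.H ⊗[ℂ] S.H)) =
      (((PreRep.tensor R.pre S.pre).toHom x ξ : R.H ⊗[ℂ] S.H) :
        UniformSpace.Completion (R.H ⊗[ℂ] S.H)) :=
  PreRep.extend_coe _ _
    (CStarSeminorm.le_sup repSeminorm (bddAbove_repSeminorm B C) (R, S)) x ξ

end MinTensor

end MinTensor

/-! ### Associativity -/

/-- The *-homomorphisms of a *-algebra into a C*-algebra. -/
abbrev StarHom (L : Type*) [NonUnitalRing L] [StarRing L] [Module ℂ L] (X : Type*)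
    [NonUnitalCStarAlgebra X] : Type _ := L →⋆ₙₐ[ℂ] X

section DenseExtension

variable {L : Type*} [NonUnitalRing L] [StarRing L] [Module ℂ L] {X Y : Type*}
  [NonUnitalCStarAlgebra X] [NonUnitalCStarAlgebra Y]

theorem extendHom_aux (e : L →⋆ₙₐ[ℂ] X) (φ : L →⋆ₙₐ[ℂ] Y) (he : DenseRange e)
    (h : ∀ x, ‖φ x‖ ≤ ‖e x‖) (x : L) :
    (φ : L →ₗ[ℂ] Y).extendOfNorm (e : L →ₗ[ℂ] X) (e x) = φ x :=
  LinearMap.extendOfNorm_eq (f := (φ : L →ₗ[ℂ] Y)) (e := (e : L →ₗ[ℂ] X)) he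
    ⟨1, fun x => by rw [one_mul]; exact h x⟩ x

/-- The *-homomorphism `X → Y` which sends `e x` to `φ x`, where `e : L → X` has dense range and
`‖φ x‖ ≤ ‖e x‖`. -/
def extendHom (e : L →⋆ₙₐ[ℂ] X) (φ : L →⋆ₙₐ[ℂ] Y) (he : DenseRange e)
    (h : ∀ x, ‖φ x‖ ≤ ‖e x‖) : X →⋆ₙₐ[ℂ] Y where
  __ := (φ : L →ₗ[ℂ] Y).extendOfNorm (e : L →ₗ[ℂ] X)
  map_zero' := map_zero ((φ : L →ₗ[ℂ] Y).extendOfNorm (e : L →ₗ[ℂ] X))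
  map_mul' x y := by
    set Φ := (φ : L →ₗ[ℂ] Y).extendOfNorm (e : L →ₗ[ℂ] X) with hΦ
    refine he.induction_on₂ (p := fun x y => Φ (x * y) = Φ x * Φ y) ?_ (fun a b => ?_) x y
    · exact isClosed_eq (by fun_prop) (by fun_prop)
    · rw [← map_mul, hΦ, extendHom_aux e φ he h, extendHom_aux e φ he h, extendHom_aux e φ he h,
        map_mul]
  map_star' x := by
    set Φ := (φ : L →ₗ[ℂ] Y).extendOfNorm (e : L →ₗ[ℂ] X) with hΦ
    refine he.induction_on (p := fun x => Φ (star x) = star (Φ x)) x ?_ (fun a => ?_)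
    · exact isClosed_eq (by fun_prop) (by fun_prop)
    · rw [← map_star, hΦ, extendHom_aux e φ he h, extendHom_aux e φ he h, map_star]

theorem extendHom_apply (e : L →⋆ₙₐ[ℂ] X) (φ : L →⋆ₙₐ[ℂ] Y) (he : DenseRange e)
    (h : ∀ x, ‖φ x‖ ≤ ‖e x‖) (x : L) : extendHom e φ he h (e x) = φ x :=
  extendHom_aux e φ he h x

end DenseExtension

section Intertwine

variable {X Y Z E₁ E₂ E₃ F : Type*} [AddCommGroup X] [Module ℂ X] [AddCommGroup Y] [Module ℂ Y]
  [AddCommGroup Z] [Module ℂ Z] [NormedAddCommGroup E₁] [InnerProductSpace ℂ E₁]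
  [NormedAddCommGroup E₂] [InnerProductSpace ℂ E₂] [NormedAddCommGroup F] [InnerProductSpace ℂ F]

theorem intertwine_right (V : E₁ ⊗[ℂ] E₂ →ₗᵢ[ℂ] F)
    (Φ : X ⊗[ℂ] Y → (E₁ ⊗[ℂ] E₂ →L[ℂ] E₁ ⊗[ℂ] E₂)) (Ψ : X ⊗[ℂ] Y → (F →L[ℂ] F))
    (hΦ₀ : Φ 0 = 0) (hΨ₀ : Ψ 0 = 0) (hΦ : ∀ x y, Φ (x + y) = Φ x + Φ y)
    (hΨ : ∀ x y, Ψ (x + y) = Ψ x + Ψ y)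
    (h : ∀ x y e f, V (Φ (x ⊗ₜ y) (e ⊗ₜ f)) = Ψ (x ⊗ₜ y) (V (e ⊗ₜ f)))
    (x : X ⊗[ℂ] Y) (ξ : E₁ ⊗[ℂ] E₂) : V (Φ x ξ) = Ψ x (V ξ) := by
  induction x using TensorProduct.induction_on with
  | zero => simp only [hΦ₀, hΨ₀, map_zero, zero_apply]
  | add x₁ x₂ h₁ h₂ => simp only [hΦ, hΨ, map_add, add_apply, h₁, h₂]
  | tmul x y =>
    induction ξ using TensorProduct.induction_on with
    | zero => simp only [map_zero]
    | add x₁ x₂ h₁ h₂ => simp only [map_add, h₁, h₂]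
    | tmul e f => exact h x y e f

variable [NormedAddCommGroup E₃] [InnerProductSpace ℂ E₃]

theorem intertwine_left (V : E₁ ⊗[ℂ] (E₂ ⊗[ℂ] E₃) →ₗᵢ[ℂ] F)
    (Φ : (X ⊗[ℂ] Y) ⊗[ℂ] Z → (E₁ ⊗[ℂ] (E₂ ⊗[ℂ] E₃) →L[ℂ] E₁ ⊗[ℂ] (E₂ ⊗[ℂ] E₃)))
    (Ψ : (X ⊗[ℂ] Y) ⊗[ℂ] Z → (F →L[ℂ] F))
    (hΦ₀ : Φ 0 = 0) (hΨ₀ : Ψ 0 = 0) (hΦ : ∀ x y, Φ (x + y) = Φ x + Φ y)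
    (hΨ : ∀ x y, Ψ (x + y) = Ψ x + Ψ y)
    (h : ∀ x y z e f g, V (Φ ((x ⊗ₜ y) ⊗ₜ z) (e ⊗ₜ (f ⊗ₜ g))) =
      Ψ ((x ⊗ₜ y) ⊗ₜ z) (V (e ⊗ₜ (f ⊗ₜ g))))
    (x : (X ⊗[ℂ] Y) ⊗[ℂ] Z) (ξ : E₁ ⊗[ℂ] (E₂ ⊗[ℂ] E₃)) : V (Φ x ξ) = Ψ x (V ξ) := by
  refine intertwine_right V Φ Ψ hΦ₀ hΨ₀ hΦ hΨ (fun w z e ζ => ?_) x ξ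
  induction w using TensorProduct.induction_on with
  | zero => simp only [TensorProduct.zero_tmul, hΦ₀, hΨ₀, map_zero, zero_apply]
  | add x₁ x₂ h₁ h₂ => simp only [TensorProduct.add_tmul, hΦ, hΨ, map_add, add_apply, h₁, h₂]
  | tmul x y =>
    induction ζ using TensorProduct.induction_on with
    | zero => simp only [TensorProduct.tmul_zero, map_zero]
    | add x₁ x₂ h₁ h₂ => simp only [TensorProduct.tmul_add, map_add, h₁, h₂]
    | tmul f g => exact h x y z e f g

end Intertwine

namespace MinTensor

variable {B : Type u} {C : Type v} {D : Type w} [NonUnitalCStarAlgebra B]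
  [NonUnitalCStarAlgebra C] [NonUnitalCStarAlgebra D]

/-- A *-homomorphism into a minimal tensor product has dense range if the closure of its range
contains the elementary tensors. -/
theorem denseRange_of_tmul {L : Type*} [NonUnitalRing L] [StarRing L] [Module ℂ L]
    (e : L →⋆ₙₐ[ℂ] MinTensor B C) (h : ∀ b c, tmul b c ∈ closure (Set.range e)) :
    DenseRange e := by
  have hcl : ∀ x : B ⊗[ℂ] C, of B C x ∈
      (LinearMap.range (e : L →ₗ[ℂ] MinTensor B C)).topologicalClosure := by
    intro x
    induction x using TensorProduct.induction_on with
    | zero => rw [map_zero]; exact zero_mem _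
    | add x₁ x₂ h₁ h₂ => rw [map_add]; exact add_mem h₁ h₂
    | tmul b c => exact h b c
  intro x
  refine (denseRange_of (B := B) (C := C)).induction_on
    (p := fun x => x ∈ closure (Set.range e)) x isClosed_closure fun a => hcl a

variable (B C D)

/-- The canonical map of the algebraic tensor product into `(B ⊗ C) ⊗ D`. -/
def assocLeftMap : StarHom ((B ⊗[ℂ] C) ⊗[ℂ] D) (MinTensor (MinTensor B C) D) :=
  (of (MinTensor B C) D).comp
    (tensorMapHom (of B C) (NonUnitalStarAlgHom.id ℂ D))

/-- The canonical map of the algebraic tensor product into `B ⊗ (C ⊗ D)`. -/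
def assocRightMap : StarHom (B ⊗[ℂ] (C ⊗[ℂ] D)) (MinTensor B (MinTensor C D)) :=
  (of B (MinTensor C D)).comp
    (tensorMapHom (NonUnitalStarAlgHom.id ℂ B) (of C D))

/-- The canonical map of `(B ⊗ C) ⊗ D` into the triple tensor product. -/
def assocLeftTo : StarHom ((B ⊗[ℂ] C) ⊗[ℂ] D) (MinTensor₃ B C D) :=
  (MinTensor₃.of B C D).comp tensorAssocHom

/-- The canonical map of `B ⊗ (C ⊗ D)` into the triple tensor product. -/
def assocRightTo : StarHom (B ⊗[ℂ] (C ⊗[ℂ] D)) (MinTensor₃ B C D) := MinTensor₃.of B C D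

theorem denseRange_assocLeftMap : DenseRange (assocLeftMap B C D) := by
  refine denseRange_of_tmul _ fun x d => ?_
  refine (denseRange_of (B := B) (C := C)).induction_on
    (p := fun x => tmul x d ∈ closure (Set.range (assocLeftMap B C D))) x ?_ fun a => ?_
  · exact isClosed_closure.preimage
      ((tmulL (B := MinTensor B C) (C := D)).flip d).continuous
  · exact subset_closure ⟨a ⊗ₜ d, rfl⟩

theorem denseRange_assocRightMap : DenseRange (assocRightMap B C D) := by
  refine denseRange_of_tmul _ fun b x => ?_
  refine (denseRange_of (B := C) (C := D)).induction_on
    (p := fun x => tmul b x ∈ closure (Set.range (assocRightMap B C D))) x ?_ fun a => ?_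
  · exact isClosed_closure.preimage (tmulL b).continuous
  · exact subset_closure ⟨b ⊗ₜ a, rfl⟩

set_option maxHeartbeats 1000000 in
theorem norm_assocLeftMap_ge (x : (B ⊗[ℂ] C) ⊗[ℂ] D) :
    ‖(assocLeftTo B C D) x‖ ≤ ‖assocLeftMap B C D x‖ := by
  refine (MinTensor₃.norm_of _).trans_le ?_
  refine CStarSeminorm.sup_le _ _ (norm_nonneg _) fun R => ?_
  rw [assocLeftMap, NonUnitalStarAlgHom.comp_apply, norm_of]
  refine le_trans ?_ (CStarSeminorm.le_sup repSeminorm (bddAbove_repSeminorm (MinTensor B C) D)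
    (rep R.1 R.2.1, R.2.2) _)
  rw [repSeminorm_apply, repSeminorm₃, PreRep.seminorm_apply]
  let V : R.1.H ⊗[ℂ] (R.2.1.H ⊗[ℂ] R.2.2.H) →ₗᵢ[ℂ]
      UniformSpace.Completion (R.1.H ⊗[ℂ] R.2.1.H) ⊗[ℂ] R.2.2.H :=
    (TensorProduct.mapIsometry UniformSpace.Completion.toComplₗᵢ .id).comp
      (TensorProduct.assocIsometry ℂ R.1.H R.2.1.H R.2.2.H).symm.toLinearIsometry
  refine PreRep.norm_le_of_intertwine V _ _ fun ξ => ?_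
  refine intertwine_left V
    (fun x => (PreRep.tensor R.1.pre (PreRep.tensor R.2.1.pre R.2.2.pre)).toHom (tensorAssocHom x))
    (fun x => (PreRep.tensor (rep R.1 R.2.1).pre R.2.2.pre).toHom
      (tensorMapHom (of B C) (NonUnitalStarAlgHom.id ℂ D) x))
    (by rw [map_zero, map_zero]) (by rw [map_zero, map_zero])
    (fun x y => by rw [map_add, map_add]) (fun x y => by rw [map_add, map_add]) ?_ x ξ
  intro b c d e f g
  exact congrArg (fun z => z ⊗ₜ[ℂ] (R.2.2.pre.toHom d g))
    (rep_coe R.1 R.2.1 (b ⊗ₜ c) (e ⊗ₜ f)).symm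

theorem norm_assocRightMap_ge (x : B ⊗[ℂ] (C ⊗[ℂ] D)) :
    ‖assocRightTo B C D x‖ ≤ ‖assocRightMap B C D x‖ := by
  refine (MinTensor₃.norm_of _).trans_le ?_
  refine CStarSeminorm.sup_le _ _ (norm_nonneg _) fun R => ?_
  rw [assocRightMap, NonUnitalStarAlgHom.comp_apply, norm_of]
  refine le_trans ?_ (CStarSeminorm.le_sup repSeminorm (bddAbove_repSeminorm B (MinTensor C D))
    (R.1, rep R.2.1 R.2.2) _)
  rw [repSeminorm_apply, repSeminorm₃, PreRep.seminorm_apply]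
  let V : R.1.H ⊗[ℂ] (R.2.1.H ⊗[ℂ] R.2.2.H) →ₗᵢ[ℂ]
      R.1.H ⊗[ℂ] UniformSpace.Completion (R.2.1.H ⊗[ℂ] R.2.2.H) :=
    TensorProduct.mapIsometry .id UniformSpace.Completion.toComplₗᵢ
  refine PreRep.norm_le_of_intertwine V _ _ fun ξ => ?_
  refine intertwine_right V
    (fun x => (PreRep.tensor R.1.pre (PreRep.tensor R.2.1.pre R.2.2.pre)).toHom x)
    (fun x => (PreRep.tensor R.1.pre (rep R.2.1 R.2.2).pre).toHom
      (tensorMapHom (NonUnitalStarAlgHom.id ℂ B) (of C D) x))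
    (map_zero _) (by rw [map_zero, map_zero])
    (fun x y => map_add _ x y) (fun x y => by rw [map_add, map_add]) ?_ x ξ
  intro b y e ζ
  exact congrArg (fun z => (R.1.pre.toHom b e) ⊗ₜ[ℂ] z) (rep_coe R.2.1 R.2.2 y ζ).symm

/-- The canonical identification of `(B ⊗ C) ⊗ D` with `B ⊗ C ⊗ D`, determined by
`(b ⊗ c) ⊗ d ↦ b ⊗ c ⊗ d`. -/
def assocLeft : MinTensor (MinTensor B C) D →⋆ₙₐ[ℂ] MinTensor₃ B C D :=
  extendHom (assocLeftMap B C D) (assocLeftTo B C D)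
    (denseRange_assocLeftMap B C D) (norm_assocLeftMap_ge B C D)

/-- The canonical identification of `B ⊗ (C ⊗ D)` with `B ⊗ C ⊗ D`, determined by
`b ⊗ (c ⊗ d) ↦ b ⊗ c ⊗ d`. -/
def assocRight : MinTensor B (MinTensor C D) →⋆ₙₐ[ℂ] MinTensor₃ B C D :=
  extendHom (assocRightMap B C D) (assocRightTo B C D)
    (denseRange_assocRightMap B C D) (norm_assocRightMap_ge B C D)

variable {B C D}

theorem assocLeft_tmul (b : B) (c : C) (d : D) :
    assocLeft B C D (tmul (tmul b c) d) =
      (MinTensor₃.of B C D) (b ⊗ₜ (c ⊗ₜ d)) :=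
  extendHom_apply _ _ (denseRange_assocLeftMap B C D) (norm_assocLeftMap_ge B C D) ((b ⊗ₜ c) ⊗ₜ d)

theorem assocRight_tmul (b : B) (c : C) (d : D) :
    assocRight B C D (tmul b (tmul c d)) =
      (MinTensor₃.of B C D) (b ⊗ₜ (c ⊗ₜ d)) :=
  extendHom_apply _ _ (denseRange_assocRightMap B C D) (norm_assocRightMap_ge B C D)
    (b ⊗ₜ (c ⊗ₜ d))

end MinTensor

/-! ### Coactions of discrete groups -/

section Coaction

variable {G : Type v} [Group G]

/-- Every *-homomorphism of the group algebra into a C*-algebra extends to `C*(G)`. -/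
def GroupCStar.lift {B : Type*} [NonUnitalCStarAlgebra B] (φ : MonoidAlgebra ℂ G →⋆ₙₐ[ℂ] B) :
    GroupCStar G →⋆ₙₐ[ℂ] B :=
  EnvelopingCStar.lift φ

theorem GroupCStar.lift_of {B : Type*} [NonUnitalCStarAlgebra B]
    (φ : MonoidAlgebra ℂ G →⋆ₙₐ[ℂ] B) (f : MonoidAlgebra ℂ G) : lift φ (of G f) = φ f :=
  EnvelopingCStar.lift_of φ f

open MonoidAlgebra in
theorem GroupCStar.unitary_mul (s t : G) : unitary (s * t) = unitary s * unitary t := by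
  rw [unitary, unitary, unitary, ← map_mul, MonoidAlgebra.single_mul_single, one_mul]

open MonoidAlgebra in
theorem GroupCStar.star_unitary (s : G) : star (unitary s) = unitary s⁻¹ := by
  rw [unitary, unitary, ← map_star, MonoidAlgebra.star_single, star_one]

/-- The linear map `s ↦ s ⊗ s` of the group algebra into `C*(G) ⊗ C*(G)`. -/
def groupComulₗ : MonoidAlgebra ℂ G →ₗ[ℂ] MinTensor (GroupCStar G) (GroupCStar G) :=
  (Finsupp.linearCombination ℂ fun s : G =>
    MinTensor.tmul (GroupCStar.unitary s) (GroupCStar.unitary s)) ∘ₗ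
    (MonoidAlgebra.coeffLinearEquiv ℂ).toLinearMap

theorem groupComulₗ_single (s : G) (c : ℂ) :
    groupComulₗ (MonoidAlgebra.single s c) =
      c • MinTensor.tmul (GroupCStar.unitary s) (GroupCStar.unitary s) := by
  simp [groupComulₗ]

/-- The *-homomorphism `s ↦ s ⊗ s` of the group algebra into `C*(G) ⊗ C*(G)`. -/
def groupComulₐ : MonoidAlgebra ℂ G →⋆ₙₐ[ℂ] MinTensor (GroupCStar G) (GroupCStar G) where
  __ := groupComulₗ (G := G)
  map_zero' := map_zero (groupComulₗ (G := G))
  map_mul' f g := by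
    change groupComulₗ (f * g) = groupComulₗ f * groupComulₗ g
    induction f using MonoidAlgebra.induction_linear with
    | zero => simp only [zero_mul, map_zero]
    | add f₁ f₂ h₁ h₂ => rw [add_mul, map_add, h₁, h₂, map_add, add_mul]
    | single s c =>
      induction g using MonoidAlgebra.induction_linear with
      | zero => simp only [mul_zero, map_zero]
      | add f₁ f₂ h₁ h₂ => rw [mul_add, map_add, h₁, h₂, map_add, mul_add]
      | single t d =>
        rw [MonoidAlgebra.single_mul_single, groupComulₗ_single, groupComulₗ_single,
          groupComulₗ_single, smul_mul_smul_comm, GroupCStar.unitary_mul, MinTensor.tmul,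
          MinTensor.tmul, MinTensor.tmul, ← map_mul, Algebra.TensorProduct.tmul_mul_tmul]
  map_star' f := by
    change groupComulₗ (star f) = star (groupComulₗ f)
    induction f using MonoidAlgebra.induction_linear with
    | zero => simp only [star_zero, map_zero]
    | add f₁ f₂ h₁ h₂ => rw [star_add, map_add, h₁, h₂, map_add, star_add]
    | single s c =>
      rw [MonoidAlgebra.star_single, groupComulₗ_single, groupComulₗ_single, star_smul,
        MinTensor.tmul, MinTensor.tmul, ← map_star, TensorProduct.star_tmul,
        GroupCStar.star_unitary]

variable (G)

/-- The comultiplication `δ_G : C*(G) → C*(G) ⊗ C*(G)`, determined by `s ↦ s ⊗ s`. -/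
def GroupCStar.comul : GroupCStar G →⋆ₙₐ[ℂ] MinTensor (GroupCStar G) (GroupCStar G) :=
  GroupCStar.lift groupComulₐ

variable {G}

theorem GroupCStar.comul_unitary (s : G) :
    GroupCStar.comul G (unitary s) = MinTensor.tmul (unitary s) (unitary s) := by
  rw [comul, unitary, lift_of]
  change groupComulₗ (MonoidAlgebra.single s 1) = _
  rw [groupComulₗ_single, one_smul, unitary]

/-- A (full) coaction of the discrete group `G` on the C*-algebra `B`: an injective nondegenerate
*-homomorphism `δ : B → B ⊗ C*(G)` into the minimal tensor product, satisfying the coaction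
identity `(δ ⊗ id) ∘ δ = (id ⊗ δ_G) ∘ δ`. -/
structure IsCoaction {B : Type (max w v)} [NonUnitalCStarAlgebra B]
    (δ : B →⋆ₙₐ[ℂ] MinTensor B (GroupCStar G)) : Prop where
  injective : Function.Injective δ
  nondegenerate : Dense (Submodule.span ℂ {z : MinTensor B (GroupCStar G) |
    ∃ (b : B) (y : MinTensor B (GroupCStar G)), z = δ b * y} : Set (MinTensor B (GroupCStar G)))
  coaction_identity : ∀ b : B,
    MinTensor.assocLeft B (GroupCStar G) (GroupCStar G)
        (MinTensor.map δ (NonUnitalStarAlgHom.id ℂ (GroupCStar G)) (δ b)) =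
      MinTensor.assocRight B (GroupCStar G) (GroupCStar G)
        (MinTensor.map (NonUnitalStarAlgHom.id ℂ B) (GroupCStar.comul G) (δ b))

/-- The spectral subspace `B_s = {b | δ b = b ⊗ s}` of a coaction. -/
def spectralSubspace {B : Type u} [NonUnitalCStarAlgebra B]
    (δ : B →⋆ₙₐ[ℂ] MinTensor B (GroupCStar G)) (s : G) : Set B :=
  {b | δ b = MinTensor.tmul b (GroupCStar.unitary s)}

end Coaction

end

noncomputable section

/-!
The dual coaction is the extension of `F(a,s) ↦ F(a,s) ⊗ s` to the enveloping C*-algebra. A vector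
functional of a representation of `C*(G)` slices the minimal tensor product back to the crossed
product, and the trivial and the regular representation give the two slices that matter.

The trivial representation sends every `b ⊗ s` to `b`, so its slice is a left inverse of the dual
coaction. The matrix coefficient of the regular representation between the basis vectors at `1` and
at `s` sends `b ⊗ t` to `b` if `t = s` and to `0` otherwise. Composed with the dual coaction it maps
the crossed product into the fibre at `s`, provided that this fibre is closed, and it fixes the
spectral subspace at `s`; hence the latter lies in the fibre.

The fibre is closed because `‖F(a,s)‖ = ‖ι a‖`, where the *-homomorphism `ι` need not be injective:
every element of its image is the image of an element of comparable norm, obtained by truncating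
self-adjoint elements with the functional calculus, so the fibre is complete.
-/

section States

open scoped ComplexOrder

variable {A : Type*} [CStarAlgebra A]

theorem norm_add_algebraMap_I_sq_le {a : A} (ha : IsSelfAdjoint a) (t : ℝ) :
    ‖a + algebraMap ℂ A (t * Complex.I)‖ ^ 2 ≤ ‖a‖ ^ 2 + t ^ 2 := by
  have h : star (a + algebraMap ℂ A (t * Complex.I)) * (a + algebraMap ℂ A (t * Complex.I)) =
      a * a + algebraMap ℂ A (t ^ 2) := by
    rw [star_add, ha.star_eq, ← algebraMap_star_comm, Complex.star_def, map_mul,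
      Complex.conj_ofReal, Complex.conj_I, mul_neg, map_neg, ← sub_eq_add_neg,
      ← (Algebra.commute_algebraMap_right (t * Complex.I) a).mul_self_sub_mul_self_eq', ← map_mul,
      sub_eq_add_neg, ← map_neg]
    congr 2
    linear_combination -(t : ℂ) ^ 2 * Complex.I_mul_I
  calc ‖a + algebraMap ℂ A (t * Complex.I)‖ ^ 2
      = ‖a * a + algebraMap ℂ A (t ^ 2)‖ := by rw [sq, ← CStarRing.norm_star_mul_self, h]
    _ ≤ ‖a * a‖ + ‖algebraMap ℂ A (t ^ 2)‖ := norm_add_le _ _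
    _ ≤ ‖a‖ ^ 2 + t ^ 2 := by
      rw [sq ‖a‖]
      gcongr
      · exact norm_mul_le a a
      · exact (NonUnitalStarAlgHom.norm_apply_le (StarAlgHom.ofId ℂ A) _).trans_eq (by simp)

-- Along `a + i t` the functional grows like `(Im f(a) + t)²` but the norm only like `‖a‖² + t²`.
theorem im_apply_eq_zero_of_norm_le_one {f : StrongDual ℂ A} (hf : ‖f‖ ≤ 1) (hf1 : f 1 = 1)
    {a : A} (ha : IsSelfAdjoint a) : (f a).im = 0 := by
  have bound (t : ℝ) : ((f a).im + t) ^ 2 ≤ ‖a‖ ^ 2 + t ^ 2 := calc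
    ((f a).im + t) ^ 2 = (f (a + algebraMap ℂ A (t * Complex.I))).im ^ 2 := by
      simp [Algebra.algebraMap_eq_smul_one, hf1]
    _ ≤ ‖f (a + algebraMap ℂ A (t * Complex.I))‖ ^ 2 := by
      rw [← sq_abs]
      gcongr
      exact Complex.abs_im_le_norm _
    _ ≤ ‖a + algebraMap ℂ A (t * Complex.I)‖ ^ 2 := by
      gcongr
      exact (f.le_of_opNorm_le hf _).trans_eq (one_mul _)
    _ ≤ ‖a‖ ^ 2 + t ^ 2 := norm_add_algebraMap_I_sq_le ha t
  by_contra h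
  have hbound := bound ((‖a‖ ^ 2 + 1) / (2 * (f a).im))
  have hmul : 2 * (f a).im * ((‖a‖ ^ 2 + 1) / (2 * (f a).im)) = ‖a‖ ^ 2 + 1 := by field_simp
  nlinarith [sq_nonneg (f a).im]

variable [PartialOrder A] [StarOrderedRing A]

theorem apply_nonneg_of_norm_le_one {f : StrongDual ℂ A} (hf : ‖f‖ ≤ 1) (hf1 : f 1 = 1)
    {a : A} (ha : 0 ≤ a) : 0 ≤ f a := by
  have hsub : ‖algebraMap ℝ A ‖a‖ - a‖ ≤ ‖a‖ := by
    have h0 : 0 ≤ algebraMap ℝ A ‖a‖ - a :=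
      sub_nonneg.2 (IsSelfAdjoint.of_nonneg ha).le_algebraMap_norm_self
    rw [CStarAlgebra.norm_le_iff_le_algebraMap _ (norm_nonneg a) h0]
    exact sub_le_self _ ha
  have hre : ‖a‖ - (f a).re ≤ ‖a‖ := calc
    ‖a‖ - (f a).re = (f (algebraMap ℝ A ‖a‖ - a)).re := by
      simp [Algebra.algebraMap_eq_smul_one, ← Complex.coe_smul, hf1]
    _ ≤ ‖f (algebraMap ℝ A ‖a‖ - a)‖ := Complex.re_le_norm _
    _ ≤ 1 * ‖a‖ := f.le_of_opNorm_le_of_le hf hsub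
    _ = ‖a‖ := one_mul _
  exact Complex.nonneg_iff.2
    ⟨by linarith, (im_apply_eq_zero_of_norm_le_one hf hf1 (.of_nonneg ha)).symm⟩

variable [Nontrivial A]

theorem norm_one_add_of_nonneg {a : A} (ha : 0 ≤ a) : ‖1 + a‖ = 1 + ‖a‖ := by
  refine le_antisymm ((norm_add_le _ _).trans_eq (by rw [norm_one])) ?_
  have h : 1 + ‖a‖ ∈ spectrum ℝ (algebraMap ℝ A 1 + a) := by
    rw [add_comm 1 ‖a‖, spectrum.add_mem_add_iff]
    exact CStarAlgebra.norm_mem_spectrum_of_nonneg ha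
  rw [map_one] at h
  exact (le_abs_self _).trans (spectrum.norm_le_norm_of_mem h)

-- As `‖1 + a‖ = 1 + ‖a‖`, a functional that norms `1 + a` also norms `1` and `a`.
theorem exists_state_apply_eq_norm {a : A} (ha : 0 ≤ a) :
    ∃ f : A →ₚ[ℂ] ℂ, f 1 = 1 ∧ f a = ‖a‖ := by
  obtain ⟨g, hg, hg_add⟩ := exists_dual_vector'' ℂ (1 + a)
  have hg_le (b : A) : ‖g b‖ ≤ ‖b‖ := (g.le_of_opNorm_le hg b).trans_eq (one_mul _)
  have hg_sum : (g 1).re + (g a).re = 1 + ‖a‖ := by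
    rw [← Complex.add_re, ← map_add, hg_add, norm_one_add_of_nonneg ha]
    exact Complex.ofReal_re _
  have hg1_le : ‖g 1‖ ≤ 1 := (hg_le 1).trans_eq norm_one
  have hga_re : (g a).re ≤ ‖a‖ := (Complex.re_le_norm _).trans (hg_le a)
  have hg1_re : (g 1).re = 1 := by linarith [Complex.re_le_norm (g 1)]
  have hg1 : g 1 = 1 := by
    have := RCLike.norm_le_re_iff_eq_norm.1 (hg1_le.trans_eq hg1_re.symm)
    rw [this, le_antisymm hg1_le (hg1_re ▸ Complex.re_le_norm (g 1))]
    norm_num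
  refine ⟨.mk₀ g fun b hb => apply_nonneg_of_norm_le_one hg hg1 hb, hg1, Complex.ext ?_ ?_⟩
  · exact (by linarith : (g a).re = ‖a‖)
  · exact im_apply_eq_zero_of_norm_le_one hg hg1 (.of_nonneg ha)

end States

namespace HilbertRep

variable {B : Type u} [NonUnitalCStarAlgebra B]

theorem exists_norm_apply_eq (b : B) :
    ∃ (R : HilbertRep B) (ξ : R.H), ‖ξ‖ = 1 ∧ ‖R.π b ξ‖ = ‖b‖ := by
  let _ : PartialOrder (Unitization ℂ B) := CStarAlgebra.spectralOrder _
  have : StarOrderedRing (Unitization ℂ B) := CStarAlgebra.spectralOrderedRing _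
  obtain ⟨f, hf1, hf⟩ := exists_state_apply_eq_norm (star_mul_self_nonneg (b : Unitization ℂ B))
  let R : HilbertRep B :=
    { H := f.GNS
      π := f.gnsNonUnitalStarAlgHom.comp (Unitization.inrNonUnitalStarAlgHom ℂ B) }
  have norm_coe (a : Unitization ℂ B) :
      ‖(f.toPreGNS a : f.GNS)‖ = √(f (star a * a)).re :=
    (UniformSpace.Completion.norm_coe _).trans (f.preGNS_norm_def _)
  refine ⟨R, (f.toPreGNS 1 : f.GNS), ?_, ?_⟩
  · rw [norm_coe, star_one, one_mul, hf1, Complex.one_re, Real.sqrt_one]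
  · have hcyclic : R.π b (f.toPreGNS 1 : f.GNS) = (f.toPreGNS (b : Unitization ℂ B) : f.GNS) := by
      refine f.gnsNonUnitalStarAlgHom_apply_coe.trans ?_
      rw [f.leftMulMapPreGNS_apply, f.ofPreGNS_toPreGNS, mul_one]
      rfl
    rw [hcyclic, norm_coe, hf, Complex.ofReal_re, CStarRing.norm_star_mul_self,
      Unitization.norm_inr, Real.sqrt_mul_self (norm_nonneg b)]

end HilbertRep

namespace MinTensor

variable {B : Type u} {C : Type v} [NonUnitalCStarAlgebra B] [NonUnitalCStarAlgebra C]

theorem tmul_mul_tmul (b b' : B) (c c' : C) :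
    tmul b c * tmul b' c' = tmul (b * b') (c * c') := by
  rw [tmul, tmul, tmul, ← map_mul, Algebra.TensorProduct.tmul_mul_tmul]

theorem star_tmul (b : B) (c : C) : star (tmul b c) = tmul (star b) (star c) := by
  rw [tmul, tmul, ← map_star, TensorProduct.star_tmul]

theorem dense_of_tmul_mem_topologicalClosure {K : Submodule ℂ (MinTensor B C)}
    (h : ∀ b c, tmul b c ∈ K.topologicalClosure) : Dense (K : Set (MinTensor B C)) := by
  intro z
  refine denseRange_of.induction_on (p := (· ∈ K.topologicalClosure)) z isClosed_closure fun x => ?_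
  induction x using TensorProduct.induction_on with
  | zero => rw [map_zero]; exact zero_mem _
  | add x₁ x₂ h₁ h₂ => rw [map_add]; exact add_mem h₁ h₂
  | tmul b c => exact h b c

theorem norm_tensor_le (R : HilbertRep B) (S : HilbertRep C) (x : B ⊗[ℂ] C) :
    ‖(PreRep.tensor R.pre S.pre).toHom x‖ ≤ ‖of B C x‖ := by
  rw [norm_of, ← repSeminorm_apply (R, S)]
  exact CStarSeminorm.le_sup repSeminorm (bddAbove_repSeminorm B C) (R, S) x

variable (S : HilbertRep C) (ζ η : S.H)

/-- The slice map `b ⊗ c ↦ ⟨η, S c ζ⟩ b` of a vector functional on the algebraic tensor product. -/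
def sliceₗ : B ⊗[ℂ] C →ₗ[ℂ] B :=
  TensorProduct.lift <| LinearMap.mk₂ ℂ (fun b c => inner ℂ η (S.π c ζ) • b)
    (fun b b' c => smul_add _ b b')
    (fun r b c => smul_comm _ r b)
    (fun b c c' => by rw [map_add, add_apply, inner_add_right, add_smul])
    (fun r b c => by rw [map_smul, smul_apply, inner_smul_right, mul_smul])

theorem sliceₗ_tmul (b : B) (c : C) : sliceₗ S ζ η (b ⊗ₜ c) = inner ℂ η (S.π c ζ) • b :=
  rfl

theorem inner_tensor_tmul (R : HilbertRep B) (ξ χ : R.H) (x : B ⊗[ℂ] C) :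
    inner ℂ (χ ⊗ₜ[ℂ] η) ((PreRep.tensor R.pre S.pre).toHom x (ξ ⊗ₜ ζ)) =
      inner ℂ χ (R.π (sliceₗ S ζ η x) ξ) := by
  induction x using TensorProduct.induction_on with
  | zero => simp only [map_zero, zero_apply, inner_zero_right]
  | add x₁ x₂ h₁ h₂ => simp only [map_add, add_apply, inner_add_right, h₁, h₂]
  | tmul b c =>
    rw [PreRep.tensor_tmul, TensorProduct.mapL_tmul, TensorProduct.inner_tmul, sliceₗ_tmul,
      map_smul, smul_apply, inner_smul_right, mul_comm]
    rfl

theorem norm_sliceₗ_le (x : B ⊗[ℂ] C) : ‖sliceₗ S ζ η x‖ ≤ ‖η‖ * ‖ζ‖ * ‖of B C x‖ := by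
  obtain ⟨R, ξ, hξ, hnorm⟩ := HilbertRep.exists_norm_apply_eq (sliceₗ S ζ η x)
  set χ := R.π (sliceₗ S ζ η x) ξ
  rw [← hnorm]
  have hχ : ‖χ‖ * ‖χ‖ ≤ ‖χ‖ * (‖η‖ * ‖ζ‖ * ‖of B C x‖) := calc
    ‖χ‖ * ‖χ‖ = ‖inner ℂ (χ ⊗ₜ[ℂ] η) ((PreRep.tensor R.pre S.pre).toHom x (ξ ⊗ₜ ζ))‖ := by
      rw [inner_tensor_tmul, inner_self_eq_norm_sq_to_K, norm_pow, RCLike.norm_ofReal, abs_norm, sq]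
    _ ≤ ‖χ ⊗ₜ[ℂ] η‖ * (‖of B C x‖ * ‖ξ ⊗ₜ[ℂ] ζ‖) :=
      (norm_inner_le_norm _ _).trans <| mul_le_mul_of_nonneg_left
        (ContinuousLinearMap.le_of_opNorm_le _ (norm_tensor_le R S x) _) (norm_nonneg _)
    _ = ‖χ‖ * (‖η‖ * ‖ζ‖ * ‖of B C x‖) := by
      rw [TensorProduct.norm_tmul, TensorProduct.norm_tmul, hξ]
      ring
  rcases (norm_nonneg χ).eq_or_lt with hzero | hpos
  · rw [← hzero]
    positivity
  · exact le_of_mul_le_mul_left hχ hpos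

/-- The slice map `MinTensor B C → B`, `b ⊗ c ↦ ⟨η, S c ζ⟩ b`, of a vector functional on `C`. -/
def slice : MinTensor B C →L[ℂ] B :=
  (sliceₗ S ζ η).extendOfNorm (of B C : B ⊗[ℂ] C →ₗ[ℂ] MinTensor B C)

theorem slice_tmul (b : B) (c : C) : slice S ζ η (tmul b c) = inner ℂ η (S.π c ζ) • b :=
  LinearMap.extendOfNorm_eq (e := (of B C : B ⊗[ℂ] C →ₗ[ℂ] MinTensor B C)) denseRange_of
    ⟨_, norm_sliceₗ_le S ζ η⟩ (b ⊗ₜ c)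

end MinTensor

namespace GroupCStar

variable {G : Type v} [Group G]

theorem unitary_one_mul (c : GroupCStar G) : unitary 1 * c = c := by
  refine (EnvelopingCStar.denseRange_of (L := MonoidAlgebra ℂ G)).induction_on
    (p := fun c : GroupCStar G => unitary 1 * c = c) c
    (isClosed_eq (by fun_prop) (by fun_prop)) fun f => ?_
  change of G (.single 1 1) * of G f = of G f
  rw [← map_mul, ← MonoidAlgebra.one_def, one_mul]

/-- The *-homomorphism `∑ cₛ s ↦ ∑ cₛ u(s)` of the group algebra given by a homomorphism `u` of the
group into the unitary group of a unital *-algebra. -/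
def algebraLift {B : Type*} [Ring B] [StarRing B] [Algebra ℂ B] [StarModule ℂ B]
    (u : G →* _root_.unitary B) : MonoidAlgebra ℂ G →⋆ₙₐ[ℂ] B where
  __ := (MonoidAlgebra.lift ℂ B G ((_root_.unitary B).subtype.comp u)).toNonUnitalAlgHom
  map_star' f := by
    change MonoidAlgebra.lift ℂ B G _ (star f) = star (MonoidAlgebra.lift ℂ B G _ f)
    induction f using MonoidAlgebra.induction_linear with
    | zero => simp only [star_zero, map_zero]
    | add f₁ f₂ h₁ h₂ => rw [star_add, map_add, h₁, h₂, map_add, star_add]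
    | single s c =>
      rw [MonoidAlgebra.star_single, MonoidAlgebra.lift_single, MonoidAlgebra.lift_single,
        star_smul, MonoidHom.comp_apply, MonoidHom.comp_apply, map_inv, ← Unitary.star_eq_inv]
      rfl

/-- The *-homomorphism of `C*(G)` given by a homomorphism of `G` into the unitary group of a unital
C*-algebra. -/
def liftUnitary {B : Type*} [CStarAlgebra B] (u : G →* _root_.unitary B) : GroupCStar G →⋆ₙₐ[ℂ] B :=
  lift (algebraLift u)

theorem liftUnitary_unitary {B : Type*} [CStarAlgebra B] (u : G →* _root_.unitary B) (s : G) :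
    liftUnitary u (unitary s) = (u s : B) :=
  (lift_of _ _).trans ((MonoidAlgebra.lift_single _ s 1).trans (one_smul ℂ _))

/-- The representation of `C*(G)` given by a unitary representation of `G`. -/
def unitaryRep {H : Type v} [NormedAddCommGroup H] [InnerProductSpace ℂ H] [CompleteSpace H]
    (u : G →* _root_.unitary (H →L[ℂ] H)) : HilbertRep (GroupCStar G) where
  H := H
  π := liftUnitary u

end GroupCStar

section RegularRepresentation

/-- The isometry `f ↦ f ∘ e⁻¹` of `ℓ²(X)` onto `ℓ²(Y)` induced by a bijection `e : X ≃ Y`. -/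
def l2Reindex {X Y E : Type*} [NormedAddCommGroup E] [NormedSpace ℂ E] (e : X ≃ Y) :
    lp (fun _ : X => E) 2 ≃ₗᵢ[ℂ] lp (fun _ : Y => E) 2 where
  toFun f := ⟨fun y => f (e.symm y), by
    have h := (memℓp_gen_iff (by norm_num)).1 (lp.memℓp f)
    exact (memℓp_gen_iff (by norm_num)).2 (e.symm.summable_iff.2 h)⟩
  invFun f := ⟨fun x => f (e x), by
    have h := (memℓp_gen_iff (by norm_num)).1 (lp.memℓp f)
    exact (memℓp_gen_iff (by norm_num)).2 (e.summable_iff.2 h)⟩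
  map_add' _ _ := rfl
  map_smul' _ _ := rfl
  left_inv f := by
    ext x
    exact congrArg f (e.symm_apply_apply x)
  right_inv f := by
    ext y
    exact congrArg f (e.apply_symm_apply y)
  norm_map' f := by
    rw [lp.norm_eq_tsum_rpow (by norm_num), lp.norm_eq_tsum_rpow (by norm_num) f]
    exact congrArg (· ^ (1 / (2 : ENNReal).toReal))
      (e.symm.tsum_eq fun x => ‖f x‖ ^ (2 : ENNReal).toReal)

variable (G : Type v) [Group G]

/-- The left regular representation of `G` on `ℓ²(G)`. -/
def leftRegular : G →* unitary (lp (fun _ : G => ℂ) 2 →L[ℂ] lp (fun _ : G => ℂ) 2) :=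
  Unitary.linearIsometryEquiv.symm.toMonoidHom.comp
    { toFun := fun s => l2Reindex (Equiv.mulLeft s)
      map_one' := by
        ext f t
        exact congrArg f ((congrArg (· * t) inv_one).trans (one_mul t))
      map_mul' := fun s t => by
        ext f x
        exact congrArg f ((congrArg (· * x) (mul_inv_rev s t)).trans (mul_assoc _ _ x)) }

variable {G}

theorem leftRegular_apply (s : G) (f : lp (fun _ : G => ℂ) 2) (t : G) :
    (leftRegular G s : lp (fun _ : G => ℂ) 2 →L[ℂ] lp (fun _ : G => ℂ) 2) f t = f (s⁻¹ * t) :=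
  rfl

open scoped Classical in
theorem inner_single_leftRegular (s t : G) :
    inner ℂ (lp.single 2 t (1 : ℂ)) ((leftRegular G s :
      lp (fun _ : G => ℂ) 2 →L[ℂ] lp (fun _ : G => ℂ) 2) (lp.single 2 1 (1 : ℂ))) =
      if s = t then (1 : ℂ) else 0 := by
  rw [lp.inner_single_left, leftRegular_apply, lp.single_apply, Pi.single_apply,
    inv_mul_eq_one]
  simp

end RegularRepresentation

namespace MinTensor

variable {G : Type v} [Group G] {B : Type u} [NonUnitalCStarAlgebra B]

theorem slice_unitaryRep_tmul_unitary {H : Type v} [NormedAddCommGroup H] [InnerProductSpace ℂ H]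
    [CompleteSpace H] (u : G →* unitary (H →L[ℂ] H)) (ζ η : H) (b : B) (s : G) :
    slice (GroupCStar.unitaryRep u) ζ η (tmul b (GroupCStar.unitary s)) =
      (inner ℂ η ((u s : H →L[ℂ] H) ζ) : ℂ) • b := by
  rw [← GroupCStar.liftUnitary_unitary u s]
  exact slice_tmul _ _ _ b _

open scoped Classical in
/-- The slice map `MinTensor B (GroupCStar G) → B` of the regular representation which reads off
the component at `s`: it sends `b ⊗ s` to `b`, and `b ⊗ t` to `0` for `t ≠ s`. -/
def component (s : G) : MinTensor B (GroupCStar G) →L[ℂ] B :=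
  slice (GroupCStar.unitaryRep (leftRegular G)) (lp.single 2 1 (1 : ℂ) : lp (fun _ : G => ℂ) 2)
    (lp.single 2 s (1 : ℂ) : lp (fun _ : G => ℂ) 2)

open scoped Classical in
theorem component_tmul_unitary (s t : G) (b : B) :
    component s (tmul b (GroupCStar.unitary t)) = if t = s then b else 0 := by
  rw [component, slice_unitaryRep_tmul_unitary, inner_single_leftRegular, ite_smul, one_smul,
    zero_smul]

variable (G B) in
open scoped Classical in
/-- The slice map `MinTensor B (GroupCStar G) → B` of the trivial representation of `G`, which sends
every `b ⊗ s` to `b`. The representation space is `ℓ²(G)` rather than `ℂ`, to lie in the universe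
of `G`. -/
def augment : MinTensor B (GroupCStar G) →L[ℂ] B :=
  slice (GroupCStar.unitaryRep (1 : G →* unitary (lp (fun _ : G => ℂ) 2 →L[ℂ] _)))
    (lp.single 2 1 (1 : ℂ) : lp (fun _ : G => ℂ) 2) (lp.single 2 1 (1 : ℂ) : lp (fun _ : G => ℂ) 2)

theorem augment_tmul_unitary (b : B) (s : G) :
    augment G B (tmul b (GroupCStar.unitary s)) = b := by
  classical
  rw [augment, slice_unitaryRep_tmul_unitary, MonoidHom.one_apply, OneMemClass.coe_one,
    one_apply_eq_self, lp.inner_single_left, lp.single_apply_self]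
  simp only [inner_self_eq_norm_sq_to_K, norm_one, RCLike.ofReal_one, one_pow, one_smul]

end MinTensor

section Lifting

open scoped CStarAlgebra ComplexStarModule

variable {A B : Type*} [NonUnitalCStarAlgebra A] [NonUnitalCStarAlgebra B] (φ : A →⋆ₙₐ[ℂ] B)

theorem exists_map_eq_norm_le_of_isSelfAdjoint {a : A} (ha : IsSelfAdjoint a) :
    ∃ b, φ b = φ a ∧ ‖b‖ ≤ ‖φ a‖ := by
  let clamp (t : ℝ) : ℝ := max (-‖φ a‖) (min ‖φ a‖ t)
  have clamp_eq {t : ℝ} (ht : ‖t‖ ≤ ‖φ a‖) : clamp t = t := by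
    rw [Real.norm_eq_abs, abs_le] at ht
    simp only [clamp, min_eq_right ht.2, max_eq_right ht.1]
  have norm_clamp_le (t : ℝ) : ‖clamp t‖ ≤ ‖φ a‖ :=
    abs_le.2 ⟨le_max_left _ _,
      max_le (neg_le_self (norm_nonneg _)) (min_le_left _ _)⟩
  have hclamp : Continuous clamp := by fun_prop
  refine ⟨cfcₙ clamp a, ?_, norm_cfcₙ_le fun t _ => norm_clamp_le t⟩
  have hφa : IsSelfAdjoint (φ a) := ha.map φ
  rw [NonUnitalStarAlgHom.map_cfcₙ φ clamp a hclamp.continuousOn (clamp_eq (by simp))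
    (map_continuous φ) ha hφa]
  conv_rhs => rw [← cfcₙ_id ℝ (φ a)]
  refine cfcₙ_congr fun t ht => clamp_eq ?_
  simpa only [id, cfcₙ_id ℝ (φ a)] using norm_apply_le_norm_cfcₙ (id : ℝ → ℝ) (φ a) ht

theorem exists_map_eq_norm_le (a : A) : ∃ b, φ b = φ a ∧ ‖b‖ ≤ 2 * ‖φ a‖ := by
  obtain ⟨x, hx, hx_norm⟩ := exists_map_eq_norm_le_of_isSelfAdjoint φ (ℜ a).2
  obtain ⟨y, hy, hy_norm⟩ := exists_map_eq_norm_le_of_isSelfAdjoint φ (ℑ a).2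
  refine ⟨x + Complex.I • y, ?_, ?_⟩
  · rw [map_add, map_smul, hx, hy, ← map_smul, ← map_add, realPart_add_I_smul_imaginaryPart]
  · calc ‖x + Complex.I • y‖ ≤ ‖x‖ + ‖y‖ :=
          (norm_add_le _ _).trans_eq (by rw [norm_smul, Complex.norm_I, one_mul])
      _ ≤ ‖φ (ℜ a)‖ + ‖φ (ℑ a)‖ := add_le_add hx_norm hy_norm
      _ = ‖ℜ (φ a)‖ + ‖ℑ (φ a)‖ := by rw [map_realPart, map_imaginaryPart]; rfl
      _ ≤ 2 * ‖φ a‖ := by linarith [realPart.norm_le (φ a), imaginaryPart.norm_le (φ a)]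

variable {φ} in
theorem isClosed_range_of_norm_eq {E : Type*} [NormedAddCommGroup E] [NormedSpace ℂ E]
    {T : A →ₗ[ℂ] E} (h : ∀ a, ‖T a‖ = ‖φ a‖) : IsClosed (LinearMap.range T : Set E) := by
  let f : NormedAddGroupHom A E := T.toAddMonoidHom.mkNormedAddGroupHom 1 fun a => by
    rw [one_mul]
    exact (h a).trans_le (NonUnitalStarAlgHom.norm_apply_le φ a)
  have hf : f.SurjectiveOnWith (LinearMap.range T).toAddSubgroup 2 := by
    rintro _ ⟨a, rfl⟩
    obtain ⟨b, hb, hb_norm⟩ := exists_map_eq_norm_le φ a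
    refine ⟨b, ?_, hb_norm.trans_eq (by rw [h])⟩
    change T b = T a
    rw [← sub_eq_zero, ← map_sub, ← norm_eq_zero, h, map_sub, hb, sub_self, norm_zero]
  refine isClosed_of_closure_subset fun x hx => ?_
  obtain ⟨a, ha, -⟩ := controlled_closure_of_complete two_pos one_pos hf x hx
  exact ⟨a, ha⟩

end Lifting

theorem mem_closure_range_mul_right {A : Type*} [NonUnitalCStarAlgebra A] (a : A) :
    a ∈ closure (Set.range (· * a)) := by
  let _ : PartialOrder A := CStarAlgebra.spectralOrder A
  have : StarOrderedRing A := CStarAlgebra.spectralOrderedRing A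
  have h := CStarAlgebra.increasingApproximateUnit A
  have := h.neBot
  exact mem_closure_of_tendsto (h.tendsto_mul_right a) (.of_forall Set.mem_range_self)

namespace PartialAction

variable {G : Type v} [Group G] {A : Type u} [NonUnitalCStarAlgebra A] {θ : PartialAction G A}

theorem F_mul_star_F (s : G) (a : θ.D s) : θ.F s a * star (θ.F s a) = θ.ι (a * star (a : A)) := by
  rw [F, ← map_star, ← map_mul, Sections.star_F, Sections.F_mul_F]
  change θ.ofSections _ = θ.ofSections (Sections.F θ 1 ⟨_, mem_one _⟩)
  refine congrArg _ (Sections.F_congr (mul_inv_cancel s) ?_)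
  exact (maps_symm s a).mulCoeff.eq ((maps_symm s a).mul (θ.maps_starCoeff s a))

theorem norm_F (s : G) (a : θ.D s) : ‖θ.F s a‖ = ‖θ.ι a‖ := by
  rw [← mul_self_inj (norm_nonneg _) (norm_nonneg _), ← CStarRing.norm_self_mul_star,
    F_mul_star_F, map_mul, map_star, CStarRing.norm_self_mul_star]

theorem isClosed_X (s : G) : IsClosed (θ.X s : Set θ.CrossedProduct) := by
  have : IsClosed (θ.D s : Set A) := θ.isClosed s
  exact isClosed_range_of_norm_eq
    (φ := θ.ι.comp (NonUnitalStarSubalgebraClass.subtype (θ.D s))) (norm_F s)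

namespace CrossedProduct

@[elab_as_elim]
theorem induction {P : θ.CrossedProduct → Prop} (b : θ.CrossedProduct)
    (isClosed : IsClosed {b | P b}) (zero : P 0) (F : ∀ s a, P (θ.F s a))
    (add : ∀ b c, P b → P c → P (b + c)) : P b := by
  refine (EnvelopingCStar.denseRange_of (L := θ.Sections)).induction_on (p := P) b isClosed ?_
  intro f
  change P (θ.ofSections f)
  induction f using Sections.induction with
  | h0 => rwa [map_zero]
  | hadd f g hf hg => rw [map_add]; exact add _ _ hf hg
  | hF s a => exact F s a

open scoped CStarAlgebra in
theorem hom_ext {C : Type*} [NonUnitalCStarAlgebra C]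
    {φ ψ : θ.CrossedProduct →⋆ₙₐ[ℂ] C} (h : ∀ s a, φ (θ.F s a) = ψ (θ.F s a)) : φ = ψ := by
  ext b
  induction b using CrossedProduct.induction with
  | isClosed => exact isClosed_eq (map_continuous φ) (map_continuous ψ)
  | zero => rw [map_zero, map_zero]
  | F s a => exact h s a
  | add b c hb hc => rw [map_add, map_add, hb, hc]

end CrossedProduct

variable (θ)

/-- The linear map `F(a,s) ↦ F(a,s) ⊗ s` on `L_c`. -/
def dualCoactionₗ : θ.Sections →ₗ[ℂ] MinTensor θ.CrossedProduct (GroupCStar G) :=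
  Sections.lift fun s =>
    (MinTensor.tmulL.flip (GroupCStar.unitary s)).toLinearMap ∘ₗ
      (θ.ofSections : θ.Sections →ₗ[ℂ] θ.CrossedProduct) ∘ₗ Sections.F θ s

theorem dualCoactionₗ_F (s : G) (a : θ.D s) :
    θ.dualCoactionₗ (Sections.F θ s a) = MinTensor.tmul (θ.F s a) (GroupCStar.unitary s) :=
  Sections.lift_F _ s a

/-- The *-homomorphism `F(a,s) ↦ F(a,s) ⊗ s` on `L_c`. -/
def dualCoactionₐ : θ.Sections →⋆ₙₐ[ℂ] MinTensor θ.CrossedProduct (GroupCStar G) where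
  __ := θ.dualCoactionₗ
  map_zero' := map_zero θ.dualCoactionₗ
  map_mul' f g := by
    change θ.dualCoactionₗ (f * g) = θ.dualCoactionₗ f * θ.dualCoactionₗ g
    induction f using Sections.induction with
    | h0 => simp only [zero_mul, map_zero]
    | hadd f₁ f₂ h₁ h₂ => rw [add_mul, map_add, h₁, h₂, map_add, add_mul]
    | hF s a =>
      induction g using Sections.induction with
      | h0 => simp only [mul_zero, map_zero]
      | hadd g₁ g₂ h₁ h₂ => rw [mul_add, map_add, h₁, h₂, map_add, mul_add]
      | hF t b =>
        rw [Sections.F_mul_F, dualCoactionₗ_F, dualCoactionₗ_F, dualCoactionₗ_F,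
          MinTensor.tmul_mul_tmul, ← GroupCStar.unitary_mul, F, F, F, ← map_mul, Sections.F_mul_F]
  map_star' f := by
    change θ.dualCoactionₗ (star f) = star (θ.dualCoactionₗ f)
    induction f using Sections.induction with
    | h0 => simp only [star_zero, map_zero]
    | hadd f₁ f₂ h₁ h₂ => rw [star_add, map_add, h₁, h₂, map_add, star_add]
    | hF s a =>
      rw [Sections.star_F, dualCoactionₗ_F, dualCoactionₗ_F, MinTensor.star_tmul,
        GroupCStar.star_unitary, F, F, ← map_star, Sections.star_F]

/-- The dual coaction of `G` on the crossed product, determined by `F(a,s) ↦ F(a,s) ⊗ s`. -/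
def dualCoaction : θ.CrossedProduct →⋆ₙₐ[ℂ] MinTensor θ.CrossedProduct (GroupCStar G) :=
  EnvelopingCStar.lift θ.dualCoactionₐ

theorem dualCoaction_F (s : G) (a : θ.D s) :
    θ.dualCoaction (θ.F s a) = MinTensor.tmul (θ.F s a) (GroupCStar.unitary s) :=
  (EnvelopingCStar.lift_of θ.dualCoactionₐ _).trans (θ.dualCoactionₗ_F s a)

open scoped CStarAlgebra in
theorem augment_dualCoaction (b : θ.CrossedProduct) :
    MinTensor.augment G θ.CrossedProduct (θ.dualCoaction b) = b := by
  induction b using CrossedProduct.induction with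
  | isClosed =>
    exact isClosed_eq
      ((MinTensor.augment G θ.CrossedProduct).continuous.comp (map_continuous θ.dualCoaction))
      continuous_id
  | zero => rw [map_zero, map_zero]
  | F s a => rw [dualCoaction_F, MinTensor.augment_tmul_unitary]
  | add b c hb hc => rw [map_add, map_add, hb, hc]

theorem dualCoaction_injective : Function.Injective θ.dualCoaction :=
  Function.LeftInverse.injective θ.augment_dualCoaction

theorem tmul_mul_mem_topologicalClosure_span_dualCoaction_mul (b x : θ.CrossedProduct)
    (c : GroupCStar G) :
    MinTensor.tmul (b * x) c ∈ (Submodule.span ℂ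
      {z | ∃ b y, z = θ.dualCoaction b * y}).topologicalClosure := by
  let T : θ.CrossedProduct →L[ℂ] MinTensor θ.CrossedProduct (GroupCStar G) :=
    MinTensor.tmulL.flip c
  change T (b * x) ∈ _
  induction b using CrossedProduct.induction with
  | isClosed => exact isClosed_closure.preimage (T.continuous.comp (continuous_mul_const x))
  | zero => rw [zero_mul, map_zero]; exact zero_mem _
  | add b₁ b₂ h₁ h₂ => rw [add_mul, map_add]; exact add_mem h₁ h₂
  | F s a =>
    refine Submodule.le_topologicalClosure _ (Submodule.subset_span
      ⟨θ.F s a, MinTensor.tmul x (GroupCStar.unitary s⁻¹ * c), ?_⟩)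
    rw [dualCoaction_F, MinTensor.tmul_mul_tmul, ← mul_assoc, ← GroupCStar.unitary_mul,
      mul_inv_cancel, GroupCStar.unitary_one_mul]
    rfl

theorem dense_span_dualCoaction_mul :
    Dense (Submodule.span ℂ {z | ∃ b y, z = θ.dualCoaction b * y} :
      Set (MinTensor θ.CrossedProduct (GroupCStar G))) := by
  refine MinTensor.dense_of_tmul_mem_topologicalClosure fun x c => ?_
  let T : θ.CrossedProduct →L[ℂ] MinTensor θ.CrossedProduct (GroupCStar G) :=
    MinTensor.tmulL.flip c
  refine closure_minimal ?_ isClosed_closure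
    (image_closure_subset_closure_image T.continuous ⟨x, mem_closure_range_mul_right x, rfl⟩)
  rintro _ ⟨_, ⟨b, rfl⟩, rfl⟩
  exact θ.tmul_mul_mem_topologicalClosure_span_dualCoaction_mul b x c

theorem dualCoaction_coaction_identity (b : θ.CrossedProduct) :
    MinTensor.assocLeft θ.CrossedProduct (GroupCStar G) (GroupCStar G)
        (MinTensor.map θ.dualCoaction (NonUnitalStarAlgHom.id ℂ (GroupCStar G))
          (θ.dualCoaction b)) =
      MinTensor.assocRight θ.CrossedProduct (GroupCStar G) (GroupCStar G)
        (MinTensor.map (NonUnitalStarAlgHom.id ℂ θ.CrossedProduct) (GroupCStar.comul G)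
          (θ.dualCoaction b)) := by
  let φ := ((MinTensor.assocLeft θ.CrossedProduct (GroupCStar G) (GroupCStar G)).comp
    (MinTensor.map θ.dualCoaction (NonUnitalStarAlgHom.id ℂ (GroupCStar G)))).comp θ.dualCoaction
  let ψ := ((MinTensor.assocRight θ.CrossedProduct (GroupCStar G) (GroupCStar G)).comp
    (MinTensor.map (NonUnitalStarAlgHom.id ℂ θ.CrossedProduct) (GroupCStar.comul G))).comp
      θ.dualCoaction
  have h : φ = ψ := CrossedProduct.hom_ext fun s a => by
    simp only [φ, ψ, NonUnitalStarAlgHom.comp_apply]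
    rw [dualCoaction_F, MinTensor.map_tmul, MinTensor.map_tmul, dualCoaction_F,
      GroupCStar.comul_unitary]
    exact (MinTensor.assocLeft_tmul _ _ _).trans (MinTensor.assocRight_tmul _ _ _).symm
  exact DFunLike.congr_fun h b

theorem isCoaction_dualCoaction : IsCoaction θ.dualCoaction :=
  ⟨θ.dualCoaction_injective, θ.dense_span_dualCoaction_mul, θ.dualCoaction_coaction_identity⟩

open scoped CStarAlgebra in
theorem component_dualCoaction_mem_X (s : G) (b : θ.CrossedProduct) :
    MinTensor.component s (θ.dualCoaction b) ∈ θ.X s := by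
  induction b using CrossedProduct.induction with
  | isClosed =>
    exact (isClosed_X s).preimage
      ((MinTensor.component s).continuous.comp (map_continuous θ.dualCoaction))
  | zero => rw [map_zero, map_zero]; exact zero_mem _
  | add b c hb hc => rw [map_add, map_add]; exact add_mem hb hc
  | F t a =>
    rw [dualCoaction_F, MinTensor.component_tmul_unitary]
    split_ifs with h
    · exact h ▸ θ.F_mem_X t a
    · exact zero_mem _

theorem spectralSubspace_dualCoaction (s : G) :
    spectralSubspace θ.dualCoaction s = Set.range (θ.F s) := by
  refine Set.Subset.antisymm (fun b (hb : θ.dualCoaction b = _) => ?_)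
    (Set.range_subset_iff.2 (θ.dualCoaction_F s))
  have h := θ.component_dualCoaction_mem_X s b
  rwa [hb, MinTensor.component_tmul_unitary, if_pos rfl] at h

end PartialAction

end

theorem mainTheorem10 {G : Type v} [Group G] {A : Type u} [NonUnitalCStarAlgebra A]
    (θ : PartialAction G A) :
    (∃! δ : θ.CrossedProduct →⋆ₙₐ[ℂ] MinTensor θ.CrossedProduct (GroupCStar G),
      IsCoaction δ ∧
        ∀ (s : G) (a : θ.D s),
          δ ((θ.m s).left a) =
            MinTensor.tmul ((θ.m s).left a : θ.CrossedProduct) (GroupCStar.unitary s)) ∧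
    ∀ δ : θ.CrossedProduct →⋆ₙₐ[ℂ] MinTensor θ.CrossedProduct (GroupCStar G),
      IsCoaction δ →
      (∀ (s : G) (a : θ.D s),
          δ ((θ.m s).left a) =
            MinTensor.tmul ((θ.m s).left a : θ.CrossedProduct) (GroupCStar.unitary s)) →
      ∀ s : G,
        spectralSubspace δ s = Set.range (fun a : θ.D s => ((θ.m s).left a : θ.CrossedProduct)) ∧
        Set.range (fun a : θ.D s => ((θ.m s).left a : θ.CrossedProduct)) =
          Set.range (fun b : θ.D s⁻¹ => ((θ.m s).right b : θ.CrossedProduct)) := by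
  have eq_dualCoaction (δ : θ.CrossedProduct →⋆ₙₐ[ℂ] MinTensor θ.CrossedProduct (GroupCStar G))
      (hδ : ∀ (s : G) (a : θ.D s), δ (θ.F s a) = .tmul (θ.F s a) (GroupCStar.unitary s)) :
      δ = θ.dualCoaction :=
    PartialAction.CrossedProduct.hom_ext fun s a => (hδ s a).trans (θ.dualCoaction_F s a).symm
  refine ⟨⟨θ.dualCoaction, ⟨θ.isCoaction_dualCoaction, θ.dualCoaction_F⟩,
    fun δ hδ => eq_dualCoaction δ hδ.2⟩, fun δ _ hδ s => ⟨?_, ?_⟩⟩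
  · rw [eq_dualCoaction δ hδ]
    exact θ.spectralSubspace_dualCoaction s
  · exact ((θ.α s).surjective.range_comp (θ.F s)).symm
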